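/- **Definitions.** A $\Box$-set $X$ consists of sets $X_n$ ($n\ge 0$) of $n$-cubes and face maps $d_i^\alpha:X_n\to X_{n-1}$ ($1\le i\le n$, $\alpha\in\{0,1\}$) with $d_i^\alpha d_j^\beta=d_{j-1}^\beta d_i^\alpha$ for $i<j$. For $c\in X_n$ and a partition $J=[J_0|J_*|J_1]$ of $\{1,\dots,n\}$, $d_Jc$ is the iterated face obtained by fixing the coordinates in $J_0$ to $0$ and those in $J_1$ to $1$; in particular $c$ has a source vertex $c_{\mathbf 0}=d_{[\{1,\dots,n\}|\emptyset|\emptyset]}c$ and a target vertex $c_{\mathbf 1}=d_{[\emptyset|\emptyset|\{1,\dots,n\}]}c$. $X$ is *proper* if for any two vertices $x_0,x_1$ there is at most one cube (of any dimension) with source $x_0$ and target $x_1$, and *non-self-linked* if every $n$-cube has exactly $\binom nk 2^{n-k}$ different iterated faces of dimension $k$, $0\le k\le n$. The geometric realization is $|X|=\bigsqcup_n X_n\times I^n/\!\sim$ with $[d_i^\alpha c,x]\sim[c,\delta_i^\alpha x]$, where $I=[0,1]$ and $\delta_i^\alpha$ inserts $\alpha$ as $i$-th coordinate. A path $p:I\to|X|$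 is a *d-path* if it has a presentation: numbers $0=t_0\le t_1\le\dots\le t_l=1$, cubes $c_i$ and continuous coordinatewise non-decreasing $\beta_i:[t_{i-1},t_i]\to I^{\dim c_i}$ with $p(t)=[c_i;\beta_i(t)]$ for $t\in[t_{i-1},t_i]$. It is *strict* if some presentation has all $\beta_i$ strictly increasing, i.e. each coordinate of $\beta_i$ is non-decreasing and takes each value other than $0,1$ at most once; it is *tame* if for some presentation all $p(t_i)$ are vertices. All path spaces carry the compact-open topology; $\vec P(X)_{x^-}^{x^+}$, $\vec S(X)_{x^-}^{x^+}$, $\vec T(X)_{x^-}^{x^+}$ are the spaces of all, all strict, and all tame d-paths from the vertex $x^-$ to the vertex $x^+$. The *collar* $C(d,X)\subset|X|$ of a cube $d$ is the union, over all cubes $c$ and partitions $J$ such that $d_Jc$ is an iterated face of $d$ (possibly $d$ itself), of the sets $\{[c;x] : x_i<\tfrac12\ (i\in J_0),\ x_i>\tfrac12\ (i\in J_1)\}$; the *star* of a vertex $x$ is $st(x)=C(x,X)$. A *cube chain* from $x^-$ to $x^+$ is a sequence $\mathbf c=(c_1,\dots,c_n)$, $n\ge1$, of cubes of positive dimension with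 $c_{1,\mathbf 0}=x^-$, $c_{i,\mathbf 1}=c_{i+1,\mathbf 0}$ and $c_{n,\mathbf 1}=x^+$; let $x_0=x^-$ and $x_i=c_{i,\mathbf 1}$. An elementary refinement replaces one cube $c_i$ by the two cubes $d_{[A|A^c|\emptyset]}c_i,\ d_{[\emptyset|A|A^c]}c_i$ for some $\emptyset\ne A\subsetneq\{1,\dots,\dim c_i\}$; refinement is the reflexive transitive closure. Put - $\vec T_{\mathbf c}(X)_{x^-}^{x^+}$: the paths in $\vec T(X)_{x^-}^{x^+}$ having a presentation with cubes $c_1,\dots,c_n$ in which each $\beta_i$ runs from $(0,\dots,0)$ to $(1,\dots,1)$; $\ \vec{ST}_{\mathbf c}(X)_{x^-}^{x^+}=\vec T_{\mathbf c}(X)_{x^-}^{x^+}\cap\vec S(X)_{x^-}^{x^+}$; - $\vec P^C_{\mathbf c}(X)_{x^-}^{x^+}$: the d-paths $p$ from $x^-$ to $x^+$ for which there are $0=t_0\le\dots\le t_n=1$ with $p([t_{i-1},t_i])\subset C(c_i,X)$ for $1\le i\le n$ and $p(t_i)\in st(x_i)$ for $0\le i\le n$; $\ \vec S^C_{\mathbf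 c}(X)_{x^-}^{x^+}=\vec P^C_{\mathbf c}(X)_{x^-}^{x^+}\cap\vec S(X)_{x^-}^{x^+}$. **Proposition.** Let $X$ be a proper non-self-linked $\Box$-set, $x^-,x^+\in X_0$, and let $\mathbf c,\mathbf c_1,\dots,\mathbf c_k$ ($k\ge1$) be cube chains in $X$ from $x^-$ to $x^+$. 1. The spaces $\vec{ST}_{\mathbf c}(X)_{x^-}^{x^+}$ and $\vec T_{\mathbf c}(X)_{x^-}^{x^+}$ are contractible. 2. The spaces $\vec S^C_{\mathbf c}(X)_{x^-}^{x^+}$ and $\vec P^C_{\mathbf c}(X)_{x^-}^{x^+}$ are contractible. 3. The intersections $\bigcap_{i=1}^k\vec S^C_{\mathbf c_i}(X)_{x^-}^{x^+}$ and $\bigcap_{i=1}^k\vec P^C_{\mathbf c_i}(X)_{x^-}^{x^+}$ are both contractible if the cube chains $\mathbf c_1,\dots,\mathbf c_k$ have a common refinement, and both empty otherwise. -/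

import Mathlib

universe u

/-- A `□`-set (pre-cubical set): sets `cube n` of `n`-cubes with face maps
`face α i = d_i^α` (`α = false` for the lower, `α = true` for the upper face; `i` counted from
`0`), subject to `d_i^α d_j^β = d_{j-1}^β d_i^α` for `i < j`. -/
structure BoxSet where
  cube : ℕ → Type u
  face : ∀ {n : ℕ}, Bool → Fin (n + 1) → cube (n + 1) → cube n
  face_face : ∀ {n : ℕ} (α β : Bool) (i j : Fin (n + 1)), i ≤ j → ∀ c : cube (n + 2),
    face α i (face β j.succ c) = face β j (face α i.castSucc c)

namespace BoxSet

/-- A cube of `X` of arbitrary dimension; `c.1` is the dimension of `c`. -/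
abbrev Cube (X : BoxSet.{u}) : Type u := Σ n, X.cube n

/-- The source (bottom) vertex, the iterate of `d_1^0`. -/
def sourceAux (X : BoxSet.{u}) : ∀ n, X.cube n → X.cube 0
  | 0, c => c
  | n + 1, c => sourceAux X n (X.face false 0 c)

/-- The target (top) vertex, the iterate of `d_1^1`. -/
def targetAux (X : BoxSet.{u}) : ∀ n, X.cube n → X.cube 0
  | 0, c => c
  | n + 1, c => targetAux X n (X.face true 0 c)

/-- The source vertex of a cube. -/
def source (X : BoxSet.{u}) (c : X.Cube) : X.cube 0 := X.sourceAux c.1 c.2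

/-- The target vertex of a cube. -/
def target (X : BoxSet.{u}) (c : X.Cube) : X.cube 0 := X.targetAux c.1 c.2

/-- A vertex as a `0`-dimensional cube. -/
def vertexCube (X : BoxSet.{u}) (x : X.cube 0) : X.Cube := ⟨0, x⟩

/-- The `□`-set whose `n`-cubes are the `(n + 1)`-cubes of `X`, with the face maps in all but
the first direction. -/
def shift (X : BoxSet.{u}) : BoxSet.{u} where
  cube n := X.cube (n + 1)
  face α i c := X.face α i.succ c
  face_face α β i j h c :=
    X.face_face α β i.succ j.succ (Fin.succ_le_succ_iff.mpr h) c

/-- The iterated face `d_{[J_0|J_*|J_1]} c` of an `n`-cube. The partition is encoded by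
`J : Fin n → Option Bool`: `J_0 = J⁻¹ (some false)`, `J_* = J⁻¹ none`, `J_1 = J⁻¹ (some true)`.
The coordinates are treated one after the other; a coordinate in `J_*` is kept by
passing to the faces in the remaining directions. -/
def iterFaceAux : ∀ (n : ℕ) (X : BoxSet.{u}), (Fin n → Option Bool) → X.cube n → X.Cube
  | 0, _, _, c => ⟨0, c⟩
  | n + 1, X, J, c =>
    match J 0 with
    | some α => iterFaceAux n X (Fin.tail J) (X.face α 0 c)
    | none =>
      ⟨(iterFaceAux n X.shift (Fin.tail J) c).1 + 1, (iterFaceAux n X.shift (Fin.tail J) c).2⟩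

/-- The iterated face `d_{[J_0|J_*|J_1]} c`. -/
def iterFace (X : BoxSet.{u}) (c : X.Cube) (J : Fin c.1 → Option Bool) : X.Cube :=
  iterFaceAux c.1 X J c.2

/-- `d` is an iterated face of `c`, possibly `c` itself. -/
def IsIterFace (X : BoxSet.{u}) (d c : X.Cube) : Prop :=
  ∃ J : Fin c.1 → Option Bool, X.iterFace c J = d

/-- At most one cube (of any dimension) with given source and target vertices. -/
def IsProper (X : BoxSet.{u}) : Prop :=
  ∀ c d : X.Cube, X.source c = X.source d → X.target c = X.target d → c = d

/-- Every `n`-cube has `(n choose k) 2^(n-k)` different iterated faces of dimension `k`. -/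
def IsNonSelfLinked (X : BoxSet.{u}) : Prop :=
  ∀ (c : X.Cube) (k : ℕ), k ≤ c.1 →
    {d : X.cube k | X.IsIterFace ⟨k, d⟩ c}.ncard = c.1.choose k * 2 ^ (c.1 - k)

/-! ### Geometric realization -/

/-- The endpoint `0` or `1` of the unit interval. -/
def endpoint : Bool → unitInterval
  | false => 0
  | true => 1

/-- The disjoint union of the spaces `{c} × I^{dim c}`. -/
abbrev PreRealization (X : BoxSet.{u}) : Type u := Σ c : X.Cube, (Fin c.1 → unitInterval)

/-- The gluing relation `[d_i^α c, x] ∼ [c, δ_i^α x]`. -/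
inductive Glue (X : BoxSet.{u}) : X.PreRealization → X.PreRealization → Prop
  | mk {n : ℕ} (α : Bool) (i : Fin (n + 1)) (c : X.cube (n + 1)) (x : Fin n → unitInterval) :
      Glue X ⟨⟨n, X.face α i c⟩, x⟩ ⟨⟨n + 1, c⟩, i.insertNth (endpoint α) x⟩

/-- The geometric realization `|X|`, with the quotient topology. -/
def Realization (X : BoxSet.{u}) : Type u := Quot X.Glue

instance (X : BoxSet.{u}) : TopologicalSpace X.Realization :=
  inferInstanceAs (TopologicalSpace (Quot X.Glue))

/-- The quotient map `q_c : I^{dim c} → |X|`, `x ↦ [c; x]`. -/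
def point (X : BoxSet.{u}) (c : X.Cube) (x : Fin c.1 → unitInterval) : X.Realization :=
  Quot.mk X.Glue ⟨c, x⟩

/-- A vertex as a point of `|X|`. -/
def vertex (X : BoxSet.{u}) (x : X.cube 0) : X.Realization :=
  X.point (X.vertexCube x) (fun i => i.elim0)

/-! ### Directed, strict and tame paths -/

/-- A path in `I^n`, restricted to `J`, all of whose components are strictly increasing: they
are increasing, and take a value other than `0` and `1` at most once. -/
def StrictlyIncreasingOn {n : ℕ} (β : unitInterval → Fin n → unitInterval) (J : Set unitInterval) : Prop :=
  MonotoneOn β J ∧ ∀ k, ∀ s ∈ J, ∀ s' ∈ J, β s k = β s' k → s = s' ∨ β s k = 0 ∨ β s k = 1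

/-- A presentation `p = [c_1;β_1] *_{t_1} ⋯ *_{t_{l-1}} [c_l;β_l]` of a path in `|X|`, with
`0 = t_0 ≤ t_1 ≤ ⋯ ≤ t_l = 1` and increasing paths `β_i : [t_{i-1},t_i] → I^{dim c_i}`.
The values of `coord i` outside the `i`-th interval are irrelevant. -/
structure Presentation (X : BoxSet.{u}) (p : C(unitInterval, X.Realization)) where
  len : ℕ
  time : Fin (len + 1) → unitInterval
  time_mono : Monotone time
  time_zero : time 0 = 0
  time_last : time (Fin.last len) = 1
  cube : Fin len → X.Cube
  coord : ∀ i, unitInterval → Fin (cube i).1 → unitInterval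
  continuousOn : ∀ i, ContinuousOn (coord i) (Set.Icc (time i.castSucc) (time i.succ))
  monotoneOn : ∀ i, MonotoneOn (coord i) (Set.Icc (time i.castSucc) (time i.succ))
  eq_point : ∀ i, ∀ s ∈ Set.Icc (time i.castSucc) (time i.succ),
    p s = X.point (cube i) (coord i s)

/-- The space of d-paths `P(X)_x^y`. -/
def dPaths (X : BoxSet.{u}) (x y : X.cube 0) : Set C(unitInterval, X.Realization) :=
  {p | p 0 = X.vertex x ∧ p 1 = X.vertex y ∧ Nonempty (X.Presentation p)}

/-- The space of strict d-paths `S(X)_x^y`. -/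
def strictPaths (X : BoxSet.{u}) (x y : X.cube 0) : Set C(unitInterval, X.Realization) :=
  {p | p ∈ X.dPaths x y ∧ ∃ P : X.Presentation p, ∀ i,
    StrictlyIncreasingOn (P.coord i) (Set.Icc (P.time i.castSucc) (P.time i.succ))}

/-- The space of tame d-paths `T(X)_x^y`. -/
def tamePaths (X : BoxSet.{u}) (x y : X.cube 0) : Set C(unitInterval, X.Realization) :=
  {p | p ∈ X.dPaths x y ∧ ∃ P : X.Presentation p, ∀ i, ∃ v, p (P.time i) = X.vertex v}

/-! ### Collars -/

/-- The open collar `[0,1/2)^{J_0} × I^{J_*} × (1/2,1]^{J_1}` of a face of `I^n`. -/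
def cubeCollar {n : ℕ} (J : Fin n → Option Bool) : Set (Fin n → unitInterval) :=
  {x | ∀ i, (J i = some false → (x i : ℝ) < 1 / 2) ∧ (J i = some true → 1 / 2 < (x i : ℝ))}

/-- The collar `C(d,X)`: the union, over all cubes `c` and all faces `d_J c` of `c` that are
iterated faces of `d` (possibly `d` itself), of the images of the collars of these faces. -/
def collar (X : BoxSet.{u}) (d : X.Cube) : Set X.Realization :=
  ⋃ (c : X.Cube) (J : Fin c.1 → Option Bool) (_ : X.IsIterFace (X.iterFace c J) d),
    X.point c '' cubeCollar J

/-- The star of a vertex. -/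
def star (X : BoxSet.{u}) (x : X.cube 0) : Set X.Realization := X.collar (X.vertexCube x)

/-! ### Cube chains -/

/-- A cube chain `(c_1, …, c_n)`, `n ≥ 1`, from `x` to `y`. -/
structure CubeChain (X : BoxSet.{u}) (x y : X.cube 0) where
  cubes : List X.Cube
  ne_nil : cubes ≠ []
  dim_pos : ∀ c ∈ cubes, 0 < c.1
  source_head : X.source (cubes.head ne_nil) = x
  target_last : X.target (cubes.getLast ne_nil) = y
  isChain : cubes.IsChain fun c d => X.target c = X.source d

/-- The lower part `d_{[A|Aᶜ|∅]} c` of an elementary refinement of a cube. -/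
noncomputable def lowerPart (X : BoxSet.{u}) (c : X.Cube) (A : Finset (Fin c.1)) : X.Cube :=
  X.iterFace c fun i => if i ∈ A then some false else none

/-- The upper part `d_{[∅|A|Aᶜ]} c` of an elementary refinement of a cube. -/
noncomputable def upperPart (X : BoxSet.{u}) (c : X.Cube) (A : Finset (Fin c.1)) : X.Cube :=
  X.iterFace c fun i => if i ∈ A then none else some true

namespace CubeChain

variable {X : BoxSet.{u}} {x y : X.cube 0}

/-- `c'` arises from `c` by replacing one cube by one of its elementary refinements. -/
def ElemRefines (c' c : X.CubeChain x y) : Prop :=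
  ∃ (a b : List X.Cube) (e : X.Cube) (A : Finset (Fin e.1)), A ≠ ∅ ∧ A ≠ Finset.univ ∧
    c.cubes = a ++ e :: b ∧ c'.cubes = a ++ X.lowerPart e A :: X.upperPart e A :: b

/-- `c'` refines `c`: reflexive and transitive closure of elementary refinement. -/
def Refines (c' c : X.CubeChain x y) : Prop := Relation.ReflTransGen ElemRefines c' c

/-- The space `T_c(X)_x^y` of (tame) d-paths subordinate to `c`: those with a presentation
`[c_1;p_1] * ⋯ * [c_n;p_n]` in which each `p_i` runs from the bottom to the top vertex of
`I^{dim c_i}`. -/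
def tameSub (c : X.CubeChain x y) : Set C(unitInterval, X.Realization) :=
  {p | p ∈ X.tamePaths x y ∧ ∃ P : X.Presentation p, List.ofFn P.cube = c.cubes ∧
    ∀ i, P.coord i (P.time i.castSucc) = 0 ∧ P.coord i (P.time i.succ) = 1}

/-- `ST_c(X)_x^y`. -/
def strictTameSub (c : X.CubeChain x y) : Set C(unitInterval, X.Realization) :=
  c.tameSub ∩ X.strictPaths x y

/-- The space `P^C_c(X)_x^y` of d-paths subordinate to the collar of `c`: for some
`0 = t_0 ≤ ⋯ ≤ t_n = 1`, the path runs on `[t_{i-1},t_i]` inside the collar of `c_i`, from the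
star of the source to the star of the target of `c_i`. -/
def collarSub (c : X.CubeChain x y) : Set C(unitInterval, X.Realization) :=
  {p | p ∈ X.dPaths x y ∧ ∃ t : Fin (c.cubes.length + 1) → unitInterval,
    Monotone t ∧ t 0 = 0 ∧ t (Fin.last _) = 1 ∧
    ∀ i : Fin c.cubes.length,
      (∀ s ∈ Set.Icc (t i.castSucc) (t i.succ), p s ∈ X.collar (c.cubes.get i)) ∧
      p (t i.castSucc) ∈ X.star (X.source (c.cubes.get i)) ∧
      p (t i.succ) ∈ X.star (X.target (c.cubes.get i))}

/-- `S^C_c(X)_x^y`. -/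
def strictCollarSub (c : X.CubeChain x y) : Set C(unitInterval, X.Realization) :=
  c.collarSub ∩ X.strictPaths x y

end CubeChain

end BoxSet

/-!
In a non-self-linked set the coordinates of each cube extend continuously to the whole realization.
The sum of the coordinates is well defined modulo `1` on the realization; its lift along a path is
the length that a tame path has covered, so it depends continuously on the path and does not depend
on the chain. A tame path is thus determined by its length function and its coordinates in the
successive cubes of the chain. Moving these coordinates, and then the length function, linearly to
those of a fixed strict path along the diagonals of the cubes contracts the spaces of tame and of
strict tame paths.

Dilating all cubes about their centres pushes the paths in collars into tame paths. Measuring how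
deep a path lies in the collars of several chains gives a dilation factor that varies continuously
with the path and works for all the chains at once. If a path is tame along two chains, properness
identifies the cubes that it passes, and cutting longer cubes where the other chain has a vertex
yields a common refinement of the chains along which every such path is tame. This turns an
intersection of path spaces into the path space of a single chain.
-/

namespace BoxSet

open scoped unitInterval

variable {X : BoxSet.{u}}

/-! ### Iterated faces -/

@[elab_as_elim]
theorem partition_induction {motive : ∀ n, (Fin n → Option Bool) → Prop}
    (free : ∀ n, motive n fun _ => none)
    (fix : ∀ (n : ℕ) (i : Fin (n + 1)) (α : Bool) (J : Fin n → Option Bool), motive n J →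
      motive (n + 1) (i.insertNth (α := fun _ => Option Bool) (some α) J))
    (n : ℕ) (J : Fin n → Option Bool) : motive n J := by
  induction n with
  | zero => exact Subsingleton.elim (fun _ => none) J ▸ free 0
  | succ n ih =>
    by_cases h : ∃ i α, J i = some α
    · obtain ⟨i, α, hi⟩ := h
      rw [← Fin.insertNth_self_removeNth i J, hi]
      exact fix n i α _ (ih _)
    · have hJ : J = fun _ => none :=
        funext fun i => Option.eq_none_iff_forall_ne_some.2 fun α hα => h ⟨i, α, hα⟩
      exact hJ ▸ free (n + 1)

theorem iterFace_insertNth {n : ℕ} (α : Bool) (i : Fin (n + 1)) (J : Fin n → Option Bool)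
    (c : X.cube (n + 1)) :
    X.iterFace ⟨n + 1, c⟩ (i.insertNth (α := fun _ => Option Bool) (some α) J) =
      X.iterFace ⟨n, X.face α i c⟩ J := by
  induction n generalizing X with
  | zero =>
    rw [Subsingleton.elim (α := Fin 1) i 0, Fin.insertNth_zero']
    rfl
  | succ n ih =>
    cases i using Fin.cases with
    | zero =>
      rw [Fin.insertNth_zero']
      rfl
    | succ i =>
      obtain ⟨a, J, rfl⟩ : ∃ a J', J = Fin.cons a J' := ⟨_, _, (Fin.cons_self_tail J).symm⟩
      rw [Fin.insertNth_succ_cons]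
      cases a with
      | some γ =>
        refine (ih i J (X.face γ 0 c)).trans ?_
        rw [← Fin.castSucc_zero, ← X.face_face γ α 0 i (Fin.zero_le i) c]
        rfl
      | none =>
        exact congrArg (fun d : X.shift.Cube => (⟨d.1 + 1, d.2⟩ : X.Cube)) (ih (X := X.shift) i J c)

theorem iterFace_none (c : X.Cube) : X.iterFace c (fun _ => none) = c := by
  obtain ⟨n, c⟩ := c
  induction n generalizing X with
  | zero => rfl
  | succ n ih =>
    exact congrArg (fun d : X.shift.Cube => (⟨d.1 + 1, d.2⟩ : X.Cube)) (ih (X := X.shift) c)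

theorem iterFace_iterFace (c : X.Cube) (J : Fin c.1 → Option Bool)
    (J' : Fin (X.iterFace c J).1 → Option Bool) :
    ∃ K, X.iterFace c K = X.iterFace (X.iterFace c J) J' := by
  obtain ⟨n, c⟩ := c
  dsimp only at J
  induction n, J using partition_induction with
  | free n =>
    revert J'
    rw [iterFace_none]
    exact fun J' => ⟨J', rfl⟩
  | fix n i α J ih =>
    revert J'
    rw [iterFace_insertNth]
    intro J'
    obtain ⟨K, hK⟩ := ih (X.face α i c) J'
    exact ⟨_, (iterFace_insertNth α i K c).trans hK⟩

theorem IsIterFace.refl (c : X.Cube) : X.IsIterFace c c :=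
  ⟨_, iterFace_none c⟩

theorem IsIterFace.trans {b c d : X.Cube} (hbc : X.IsIterFace b c) (hcd : X.IsIterFace c d) :
    X.IsIterFace b d := by
  obtain ⟨J, rfl⟩ := hcd
  obtain ⟨J', rfl⟩ := hbc
  exact iterFace_iterFace d J J'

theorem isIterFace_iterFace_of_le (c : X.Cube) {J J' : Fin c.1 → Option Bool}
    (h : ∀ i α, J i = some α → J' i = some α) :
    X.IsIterFace (X.iterFace c J') (X.iterFace c J) := by
  obtain ⟨n, c⟩ := c
  dsimp only at J J' h
  induction n, J using partition_induction with
  | free n =>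
    rw [iterFace_none]
    exact ⟨J', rfl⟩
  | fix n i α J ih =>
    have hi : J' i = some α := h i α (by simp)
    rw [← Fin.insertNth_self_removeNth i J', hi, iterFace_insertNth, iterFace_insertNth]
    exact ih _ fun k γ hk => h _ γ (by simpa using hk)

/-! ### Vertices of a cube -/

/-- The vertex of the cube `c` with coordinates `w`. -/
def vertexAt (X : BoxSet.{u}) : ∀ {n : ℕ}, X.cube n → (Fin n → Bool) → X.cube 0
  | 0, c, _ => c
  | _ + 1, c, w => X.vertexAt (X.face (w 0) 0 c) (Fin.tail w)

theorem iterFace_some (c : X.Cube) (w : Fin c.1 → Bool) :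
    X.iterFace c (fun i => some (w i)) = X.vertexCube (X.vertexAt c.2 w) := by
  obtain ⟨n, c⟩ := c
  induction n with
  | zero => rfl
  | succ n ih => exact ih _ _

theorem vertexAt_insertNth {n : ℕ} (α : Bool) (i : Fin (n + 1)) (c : X.cube (n + 1))
    (w : Fin n → Bool) :
    X.vertexAt c (i.insertNth (α := fun _ => Bool) α w) = X.vertexAt (X.face α i c) w := by
  have hw : (i.insertNth (α := fun _ => Option Bool) (some α) fun k => some (w k)) =
      fun k => some (i.insertNth (α := fun _ => Bool) α w k) := by
    rw [Fin.insertNth_eq_iff]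
    exact ⟨by simp, funext fun k => by simp [Fin.removeNth]⟩
  have h := iterFace_insertNth α i (fun k => some (w k)) c
  rw [hw, iterFace_some ⟨n + 1, c⟩, iterFace_some ⟨n, X.face α i c⟩] at h
  simpa [vertexCube] using h

theorem source_eq_vertexAt (c : X.Cube) : X.source c = X.vertexAt c.2 fun _ => false := by
  obtain ⟨n, c⟩ := c
  induction n with
  | zero => rfl
  | succ n ih => exact ih _

theorem target_eq_vertexAt (c : X.Cube) : X.target c = X.vertexAt c.2 fun _ => true := by
  obtain ⟨n, c⟩ := c
  induction n with
  | zero => rfl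
  | succ n ih => exact ih _

theorem getD_insertNth {n : ℕ} (i : Fin (n + 1)) (α b : Bool) (J : Fin n → Option Bool) :
    (fun k => (i.insertNth (α := fun _ => Option Bool) (some α) J k).getD b) =
      i.insertNth (α := fun _ => Bool) α fun k => (J k).getD b := by
  rw [Fin.eq_insertNth_iff]
  exact ⟨by simp, funext fun k => by simp [Fin.removeNth]⟩

theorem source_iterFace (c : X.Cube) (J : Fin c.1 → Option Bool) :
    X.source (X.iterFace c J) = X.vertexAt c.2 fun i => (J i).getD false := by
  obtain ⟨n, c⟩ := c
  dsimp only at J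
  induction n, J using partition_induction with
  | free n => rw [iterFace_none, source_eq_vertexAt]; rfl
  | fix n i α J ih => rw [iterFace_insertNth, ih, getD_insertNth, vertexAt_insertNth]

theorem target_iterFace (c : X.Cube) (J : Fin c.1 → Option Bool) :
    X.target (X.iterFace c J) = X.vertexAt c.2 fun i => (J i).getD true := by
  obtain ⟨n, c⟩ := c
  dsimp only at J
  induction n, J using partition_induction with
  | free n => rw [iterFace_none, target_eq_vertexAt]; rfl
  | fix n i α J ih => rw [iterFace_insertNth, ih, getD_insertNth, vertexAt_insertNth]

/-! ### Points on iterated faces -/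

/-- The point `y` of `I^n` lies on the face described by `J`. -/
def OnFace {n : ℕ} (J : Fin n → Option Bool) (y : Fin n → I) : Prop :=
  ∀ i α, J i = some α → y i = endpoint α

theorem point_face {n : ℕ} (α : Bool) (i : Fin (n + 1)) (c : X.cube (n + 1)) (x : Fin n → I) :
    X.point ⟨n, X.face α i c⟩ x =
      X.point ⟨n + 1, c⟩ (i.insertNth (α := fun _ => I) (endpoint α) x) :=
  Quot.sound (Glue.mk α i c x)

theorem exists_freeIndex (c : X.Cube) (J : Fin c.1 → Option Bool) :
    ∃ ι : Fin (X.iterFace c J).1 → Fin c.1, Function.Injective ι ∧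
      (∀ i, i ∈ Set.range ι ↔ J i = none) ∧
      ∀ y, OnFace J y → X.point (X.iterFace c J) (y ∘ ι) = X.point c y := by
  obtain ⟨n, c⟩ := c
  dsimp only at J
  induction n, J using partition_induction with
  | free n =>
    rw [iterFace_none]
    exact ⟨id, Function.injective_id, by simp, fun y _ => rfl⟩
  | fix n i α J ih =>
    rw [iterFace_insertNth]
    obtain ⟨ι, hι, hrange, hpoint⟩ := ih (X.face α i c)
    refine ⟨i.succAbove ∘ ι, Fin.succAbove_right_injective.comp hι, fun k => ?_, fun y hy => ?_⟩
    · cases k using Fin.succAboveCases i with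
      | x => simp
      | p k => simpa using hrange k
    · have hyi : i.insertNth (α := fun _ => I) (endpoint α) (i.removeNth y) = y := by
        rw [← hy i α (by simp), Fin.insertNth_self_removeNth]
      have h := hpoint (i.removeNth y) fun k γ hk => hy _ γ (by simpa using hk)
      rwa [point_face, hyi] at h

/-- The directions of `c` that remain free in the iterated face `d_J c`. -/
noncomputable def freeIndex (c : X.Cube) (J : Fin c.1 → Option Bool) :
    Fin (X.iterFace c J).1 → Fin c.1 :=
  (exists_freeIndex c J).choose

theorem freeIndex_injective (c : X.Cube) (J : Fin c.1 → Option Bool) :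
    Function.Injective (freeIndex c J) :=
  (exists_freeIndex c J).choose_spec.1

theorem mem_range_freeIndex {c : X.Cube} {J : Fin c.1 → Option Bool} {i : Fin c.1} :
    i ∈ Set.range (freeIndex c J) ↔ J i = none :=
  (exists_freeIndex c J).choose_spec.2.1 i

theorem point_iterFace_comp_freeIndex {c : X.Cube} {J : Fin c.1 → Option Bool} {y : Fin c.1 → I}
    (hy : OnFace J y) : X.point (X.iterFace c J) (y ∘ freeIndex c J) = X.point c y :=
  (exists_freeIndex c J).choose_spec.2.2 y hy

/-- The inclusion of the iterated face `d_J c` into the cube `c`, in coordinates. -/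
noncomputable def faceInclusion (c : X.Cube) (J : Fin c.1 → Option Bool)
    (z : Fin (X.iterFace c J).1 → I) : Fin c.1 → I :=
  Function.extend (freeIndex c J) z fun i => endpoint ((J i).getD false)

theorem faceInclusion_freeIndex (c : X.Cube) (J : Fin c.1 → Option Bool)
    (z : Fin (X.iterFace c J).1 → I) (k : Fin (X.iterFace c J).1) :
    faceInclusion c J z (freeIndex c J k) = z k :=
  (freeIndex_injective c J).extend_apply z _ k

theorem onFace_faceInclusion (c : X.Cube) (J : Fin c.1 → Option Bool)
    (z : Fin (X.iterFace c J).1 → I) : OnFace J (faceInclusion c J z) := by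
  intro i α hi
  have hfixed : ¬ ∃ k, freeIndex c J k = i := fun h => by
    simpa [hi] using mem_range_freeIndex.1 h
  rw [faceInclusion, Function.extend_apply' _ _ _ hfixed, hi, Option.getD_some]

theorem point_faceInclusion (c : X.Cube) (J : Fin c.1 → Option Bool)
    (z : Fin (X.iterFace c J).1 → I) :
    X.point c (faceInclusion c J z) = X.point (X.iterFace c J) z := by
  rw [← point_iterFace_comp_freeIndex (onFace_faceInclusion c J z)]
  exact congrArg _ (funext (faceInclusion_freeIndex c J z))

theorem faceInclusion_mono (c : X.Cube) (J : Fin c.1 → Option Bool) :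
    Monotone (faceInclusion c J) := by
  intro z z' hz i
  cases hi : J i with
  | none =>
    obtain ⟨k, rfl⟩ := mem_range_freeIndex.2 hi
    simpa only [faceInclusion_freeIndex] using hz k
  | some α => rw [onFace_faceInclusion c J z i α hi, onFace_faceInclusion c J z' i α hi]

theorem IsIterFace.point_mem_range {c d : X.Cube} (h : X.IsIterFace d c) (z : Fin d.1 → I) :
    X.point d z ∈ Set.range (X.point c) := by
  obtain ⟨J, rfl⟩ := h
  exact ⟨_, point_faceInclusion c J z⟩

theorem eq_vertex_of_mem_range {v : X.cube 0} {z : X.Realization}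
    (h : z ∈ Set.range (X.point (X.vertexCube v))) : z = X.vertex v := by
  obtain ⟨x, rfl⟩ := h
  exact congrArg (X.point _) (Subsingleton.elim (α := Fin 0 → I) _ _)

theorem point_endpoint (c : X.Cube) (w : Fin c.1 → Bool) :
    X.point c (fun i => endpoint (w i)) = X.vertex (X.vertexAt c.2 w) := by
  apply eq_vertex_of_mem_range
  rw [← iterFace_some, ← point_iterFace_comp_freeIndex (J := fun i => some (w i))
    fun i α h => by rw [Option.some.inj h]]
  exact Set.mem_range_self _

theorem point_zero (c : X.Cube) : X.point c 0 = X.vertex (X.source c) := by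
  rw [source_eq_vertexAt, ← point_endpoint]
  rfl

theorem point_one (c : X.Cube) : X.point c 1 = X.vertex (X.target c) := by
  rw [target_eq_vertexAt, ← point_endpoint]
  rfl

/-! ### Vertices of cubes in non-self-linked sets -/

theorem exists_eq_vertexAt {c : X.Cube} {v : X.cube 0} (h : X.IsIterFace (X.vertexCube v) c) :
    ∃ w, X.vertexAt c.2 w = v := by
  obtain ⟨J, hJ⟩ := h
  have hfixed (i : Fin c.1) : J i ≠ none := fun hi => by
    obtain ⟨k, -⟩ := mem_range_freeIndex.2 hi
    rw [hJ] at k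
    exact k.elim0
  have hw : J = fun i => some ((J i).getD false) :=
    funext fun i => by
      obtain ⟨α, hα⟩ := Option.ne_none_iff_exists'.1 (hfixed i)
      simp [hα]
  rw [hw, iterFace_some] at hJ
  exact ⟨_, by simpa [vertexCube] using hJ⟩

theorem IsNonSelfLinked.vertexAt_injective (hX : X.IsNonSelfLinked) (c : X.Cube) :
    Function.Injective (X.vertexAt c.2) := by
  have hvertices : {v : X.cube 0 | X.IsIterFace ⟨0, v⟩ c} = X.vertexAt c.2 '' Set.univ := by
    rw [Set.image_univ]
    refine Set.Subset.antisymm (fun v hv => exists_eq_vertexAt hv) ?_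
    rintro _ ⟨w, rfl⟩
    exact ⟨_, iterFace_some c w⟩
  have hcard := hX c 0 (Nat.zero_le _)
  rw [hvertices] at hcard
  refine Set.injOn_univ.1 ((Set.ncard_image_iff Set.finite_univ).1 ?_)
  rw [hcard]
  simp [Set.ncard_univ]

/-! ### Continuous maps out of the realization -/

theorem continuous_point (c : X.Cube) : Continuous (X.point c) :=
  continuous_quot_mk.comp continuous_sigmaMk

theorem exists_point_eq (z : X.Realization) : ∃ c x, X.point c x = z := by
  induction z using Quot.ind with
  | mk a => exact ⟨a.1, a.2, rfl⟩

/-- The continuous map on the realization induced by continuous maps on the cubes that are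
compatible with the face maps. -/
def desc {Y : Type*} [TopologicalSpace Y] (f : ∀ {n}, X.cube n → (Fin n → I) → Y)
    (hf : ∀ {n} (c : X.cube n), Continuous (f c))
    (hface : ∀ {n} α (i : Fin (n + 1)) c x,
      f c (i.insertNth (α := fun _ => I) (endpoint α) x) = f (X.face α i c) x) :
    C(X.Realization, Y) where
  toFun := Quot.lift (fun a => f a.1.2 a.2) (by
    rintro _ _ ⟨α, i, c, x⟩
    exact (hface α i c x).symm)
  continuous_toFun := continuous_quot_lift _ (continuous_sigma fun c => hf c.2)

/-! ### Extended cube coordinates -/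

/-- The weight of the vertex `w` at the point `x` of `I^n`, for multilinear interpolation. -/
def vertexWeight {n : ℕ} (x : Fin n → I) (w : Fin n → Bool) : ℝ :=
  ∏ i, if w i then (x i : ℝ) else 1 - x i

theorem vertexWeight_insertNth {n : ℕ} (i : Fin (n + 1)) (α b : Bool) (x : Fin n → I)
    (w : Fin n → Bool) :
    vertexWeight (i.insertNth (α := fun _ => I) (endpoint α) x)
      (i.insertNth (α := fun _ => Bool) b w) = if b = α then vertexWeight x w else 0 := by
  rw [vertexWeight, Fin.prod_univ_succAbove _ i]
  simp only [Fin.insertNth_apply_same, Fin.insertNth_apply_succAbove]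
  cases b <;> cases α <;> simp [endpoint, vertexWeight]

theorem sum_vertexWeight_mul_indicator {n : ℕ} (x : Fin n → I) (j : Fin n) :
    ∑ w, vertexWeight x w * (if w j then 1 else 0) = (x j : ℝ) := by
  have hterm (w : Fin n → Bool) : vertexWeight x w * (if w j then 1 else 0) =
      ∏ i, (if w i then (x i : ℝ) else if i = j then 0 else 1 - x i) := by
    by_cases hw : w j
    · simp only [vertexWeight, hw, if_true, mul_one]
      refine Finset.prod_congr rfl fun i _ => ?_
      by_cases hi : i = j
      · simp [hi, hw]
      · simp [hi]
    · simp only [hw, Bool.false_eq_true, if_false, mul_zero]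
      exact (Finset.prod_eq_zero (Finset.mem_univ j) (by simp [hw])).symm
  simp only [hterm]
  rw [← Fintype.piFinset_univ, ← Finset.prod_univ_sum (fun _ => (Finset.univ : Finset Bool))
    (fun i b => if b then (x i : ℝ) else if i = j then 0 else 1 - x i),
    Finset.prod_eq_single_of_mem j (Finset.mem_univ j) fun i _ hi => by simp [hi]]
  simp

/-- The multilinear function on the cube `c` with given values at the vertices. -/
def multilinear (g : X.cube 0 → ℝ) {n : ℕ} (c : X.cube n) (x : Fin n → I) : ℝ :=
  ∑ w, vertexWeight x w * g (X.vertexAt c w)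

theorem continuous_multilinear (g : X.cube 0 → ℝ) {n : ℕ} (c : X.cube n) :
    Continuous (multilinear g c) := by
  refine continuous_finsetSum _ fun w _ => Continuous.mul ?_ continuous_const
  refine continuous_finsetProd _ fun i _ => ?_
  split_ifs <;> fun_prop

theorem multilinear_face (g : X.cube 0 → ℝ) {n : ℕ} (α : Bool) (i : Fin (n + 1))
    (c : X.cube (n + 1)) (x : Fin n → I) :
    multilinear g c (i.insertNth (α := fun _ => I) (endpoint α) x) =
      multilinear g (X.face α i c) x := by
  rw [multilinear, ← (Fin.insertNthEquiv (fun _ => Bool) i).sum_comp, Fintype.sum_prod_type]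
  change ∑ b, ∑ w, vertexWeight _ (i.insertNth (α := fun _ => Bool) b w) *
    g (X.vertexAt c (i.insertNth (α := fun _ => Bool) b w)) = _
  simp only [vertexWeight_insertNth, ite_mul, zero_mul]
  rw [Finset.sum_eq_single_of_mem α (Finset.mem_univ α) fun b _ hb => by simp [hb]]
  simp only [if_true, vertexAt_insertNth, multilinear]

/-- The function on `|X|` that is multilinear on each cube, with given values at the vertices. -/
def multilinearExtension (g : X.cube 0 → ℝ) : C(X.Realization, ℝ) :=
  desc (multilinear g) (continuous_multilinear g) (multilinear_face g)

open Classical in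
/-- The coordinates on the cube `c`, extended continuously to `|X|`: the `j`-th one interpolates
the indicator function of the vertices of `c` on the upper `j`-th face. This is a left inverse of
`X.point c` when `X` is non-self-linked. -/
noncomputable def coords (c : X.Cube) (z : X.Realization) (j : Fin c.1) : I :=
  Set.projIcc 0 1 zero_le_one (multilinearExtension
    (fun v => if ∃ w, X.vertexAt c.2 w = v ∧ w j = true then 1 else 0) z)

theorem continuous_coords (c : X.Cube) : Continuous (coords c) :=
  continuous_pi fun _ => continuous_projIcc.comp (ContinuousMap.continuous _)

theorem IsNonSelfLinked.coords_point (hX : X.IsNonSelfLinked) (c : X.Cube) (x : Fin c.1 → I) :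
    coords c (X.point c x) = x := by
  classical
  funext j
  have hvertex (w : Fin c.1 → Bool) :
      (∃ w', X.vertexAt c.2 w' = X.vertexAt c.2 w ∧ w' j = true) ↔ w j = true := by
    constructor
    · rintro ⟨w', hw', hj⟩
      rwa [← hX.vertexAt_injective c hw']
    · exact fun hj => ⟨w, rfl, hj⟩
  have hvalue : multilinear (fun v => if ∃ w, X.vertexAt c.2 w = v ∧ w j = true then 1 else 0)
      c.2 x = (x j : ℝ) := by
    simp only [multilinear, hvertex]
    exact sum_vertexWeight_mul_indicator x j
  exact (congrArg (Set.projIcc (0 : ℝ) 1 zero_le_one) hvalue).trans (Set.projIcc_val _ _)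

theorem IsNonSelfLinked.point_injective (hX : X.IsNonSelfLinked) (c : X.Cube) :
    Function.Injective (X.point c) :=
  Function.LeftInverse.injective (hX.coords_point c)

theorem IsNonSelfLinked.point_coords (hX : X.IsNonSelfLinked) {c : X.Cube} {z : X.Realization}
    (hz : z ∈ Set.range (X.point c)) : X.point c (coords c z) = z := by
  obtain ⟨x, rfl⟩ := hz
  rw [hX.coords_point]

theorem vertex_injective : Function.Injective X.vertex := by
  classical
  intro v w h
  by_contra hvw
  have hvalue := congrArg (multilinearExtension fun z => if z = v then 1 else 0) h
  change ∑ b : Fin 0 → Bool, (∏ i : Fin 0, _) * _ = ∑ b : Fin 0 → Bool, (∏ i : Fin 0, _) * _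
    at hvalue
  simp [vertexCube, vertexAt, Ne.symm hvw] at hvalue

/-! ### Phase, vertex defect and carrier -/

/-- The sum of the coordinates of a point, modulo `1`: coordinates `0` and `1` that disappear
under the gluing do not contribute. -/
noncomputable def phase : C(X.Realization, AddCircle (1 : ℝ)) :=
  desc (fun {_} _ x => ((∑ i, (x i : ℝ) : ℝ) : AddCircle (1 : ℝ)))
    (fun _ => (AddCircle.continuous_mk' 1).comp (by fun_prop))
    (fun α i _ x => by
      simp only [Fin.sum_univ_succAbove _ i, Fin.insertNth_apply_same,
        Fin.insertNth_apply_succAbove, AddCircle.coe_add]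
      cases α <;> simp [endpoint, AddCircle.coe_period])

theorem phase_point (c : X.Cube) (x : Fin c.1 → I) :
    phase (X.point c x) = ((∑ i, (x i : ℝ) : ℝ) : AddCircle (1 : ℝ)) := rfl

/-- The sum of `x_i (1 - x_i)` over all coordinates, which vanishes exactly at the vertices. -/
noncomputable def vertexDefect : C(X.Realization, ℝ) :=
  desc (fun {_} _ x => ∑ i, (x i : ℝ) * (1 - x i)) (fun _ => by fun_prop) (fun α i _ x => by
    simp only [Fin.sum_univ_succAbove _ i, Fin.insertNth_apply_same,
      Fin.insertNth_apply_succAbove]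
    cases α <;> simp [endpoint])

theorem exists_eq_endpoint_of_point_eq_vertex {c : X.Cube} {x : Fin c.1 → I} {v : X.cube 0}
    (h : X.point c x = X.vertex v) : ∃ w : Fin c.1 → Bool, x = fun i => endpoint (w i) := by
  have hdefect : ∑ i, (x i : ℝ) * (1 - x i) = 0 :=
    (congrArg vertexDefect h).trans (Fin.sum_univ_zero Fin.elim0)
  rw [Finset.sum_eq_zero_iff_of_nonneg fun i _ =>
    mul_nonneg (x i).2.1 (sub_nonneg.2 (x i).2.2)] at hdefect
  have hendpoint (i : Fin c.1) : ∃ α, x i = endpoint α := by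
    rcases mul_eq_zero.1 (hdefect i (Finset.mem_univ i)) with h0 | h1
    · exact ⟨false, Subtype.ext h0⟩
    · exact ⟨true, Subtype.ext (sub_eq_zero.1 h1).symm⟩
  choose w hw using hendpoint
  exact ⟨w, funext hw⟩

/-- The smallest face of `I^n` containing `x`. -/
noncomputable def minFace {n : ℕ} (x : Fin n → I) (i : Fin n) : Option Bool :=
  if x i = 0 then some false else if x i = 1 then some true else none

theorem onFace_minFace {n : ℕ} (x : Fin n → I) : OnFace (minFace x) x := by
  intro i α h
  rw [minFace] at h
  split_ifs at h with h0 h1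
  · exact Option.some.inj h ▸ h0
  · exact Option.some.inj h ▸ h1

theorem minFace_insertNth {n : ℕ} (i : Fin (n + 1)) (α : Bool) (x : Fin n → I) :
    minFace (i.insertNth (α := fun _ => I) (endpoint α) x) =
      i.insertNth (α := fun _ => Option Bool) (some α) (minFace x) := by
  rw [Fin.eq_insertNth_iff]
  exact ⟨by cases α <;> simp [minFace, endpoint], funext fun k => by simp [minFace, Fin.removeNth]⟩

/-- The unique cube whose interior contains a given point. -/
noncomputable def carrier : X.Realization → X.Cube :=
  Quot.lift (fun a => X.iterFace a.1 (minFace a.2)) (by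
    rintro _ _ ⟨α, i, c, x⟩
    simp only [minFace_insertNth]
    exact (iterFace_insertNth α i _ c).symm)

theorem carrier_point (c : X.Cube) (x : Fin c.1 → I) :
    carrier (X.point c x) = X.iterFace c (minFace x) := rfl

/-! ### Depth in a collar -/

/-- How deep a coordinate lies in the collar described by one entry of a partition, normalised to
be `1` on the corresponding face of the cube and `0` outside of the collar. -/
noncomputable def depth : Option Bool → I → I
  | none, _ => 1
  | some α, x => Set.projIcc 0 1 zero_le_one (1 - 2 * |(x - endpoint α : ℝ)|)

theorem continuous_depth (a : Option Bool) : Continuous (depth a) := by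
  cases a with
  | none => exact continuous_const
  | some α => exact continuous_projIcc.comp (by fun_prop)

theorem depth_some_endpoint (α : Bool) : depth (some α) (endpoint α) = 1 :=
  Set.projIcc_of_right_le zero_le_one (by simp)

theorem depth_some_not_endpoint (α : Bool) : depth (some !α) (endpoint α) = 0 :=
  Set.projIcc_of_le_left zero_le_one (by cases α <;> norm_num [endpoint])

theorem le_depth_some_iff {η x : I} {α : Bool} (hη : 0 < η) :
    η ≤ depth (some α) x ↔ (η : ℝ) ≤ 1 - 2 * |(x - endpoint α : ℝ)| := by
  have hη' : (0 : ℝ) < η := hη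
  rw [depth, ← Subtype.coe_le_coe, Set.coe_projIcc, le_max_iff, le_min_iff]
  exact ⟨fun h => h.elim (fun h => absurd h hη'.not_ge) And.right, fun h => Or.inr ⟨η.2.2, h⟩⟩

theorem depth_pos {a : Option Bool} {x : I} (hfalse : a = some false → (x : ℝ) < 1 / 2)
    (htrue : a = some true → 1 / 2 < (x : ℝ)) : 0 < depth a x := by
  rcases a with _ | α
  · exact zero_lt_one
  · rw [depth, ← Subtype.coe_lt_coe, Set.coe_projIcc]
    refine lt_max_of_lt_right (lt_min one_pos ?_)
    cases α
    · have := hfalse rfl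
      simp only [endpoint, Set.Icc.coe_zero, sub_zero, abs_of_nonneg x.2.1]
      linarith
    · have := htrue rfl
      simp only [endpoint, Set.Icc.coe_one, Set.Icc.coe_zero, abs_of_nonpos (sub_nonpos.2 x.2.2)]
      linarith

/-- How deep a point of a cube lies in the collar of a face of this cube. -/
noncomputable def faceDepth {n : ℕ} (J : Fin n → Option Bool) (x : Fin n → I) : I :=
  Finset.univ.inf fun i => depth (J i) (x i)

theorem faceDepth_insertNth {n : ℕ} (i : Fin (n + 1)) (a : Option Bool) (y : I)
    (J : Fin n → Option Bool) (x : Fin n → I) :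
    faceDepth (i.insertNth (α := fun _ => Option Bool) a J)
      (i.insertNth (α := fun _ => I) y x) = depth a y ⊓ faceDepth J x := by
  refine le_antisymm (le_inf ?_ (Finset.le_inf fun k _ => ?_)) (Finset.le_inf fun k _ => ?_)
  · exact (Finset.inf_le (Finset.mem_univ i)).trans (by simp)
  · exact (Finset.inf_le (Finset.mem_univ (i.succAbove k))).trans (by simp)
  · cases k using Fin.succAboveCases i with
    | x => simp
    | p k =>
      simp only [Fin.insertNth_apply_succAbove]
      exact inf_le_right.trans (Finset.inf_le (Finset.mem_univ k))

open Classical in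
/-- How deep a point of the cube `c` lies in the collars of the common faces of `c` and `d`. -/
noncomputable def cubeDepth (d : X.Cube) {n : ℕ} (c : X.cube n) (x : Fin n → I) : I :=
  Finset.univ.sup fun J : Fin n → Option Bool =>
    if X.IsIterFace (X.iterFace ⟨n, c⟩ J) d then faceDepth J x else 0

theorem faceDepth_le_cubeDepth {d : X.Cube} {n : ℕ} {c : X.cube n} {J : Fin n → Option Bool}
    (hJ : X.IsIterFace (X.iterFace ⟨n, c⟩ J) d) (x : Fin n → I) :
    faceDepth J x ≤ cubeDepth d c x := by
  classical
  refine le_trans ?_ (Finset.le_sup (Finset.mem_univ J))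
  rw [if_pos hJ]

theorem cubeDepth_le {d : X.Cube} {n : ℕ} {c : X.cube n} {x : Fin n → I} {η : I}
    (h : ∀ J, X.IsIterFace (X.iterFace ⟨n, c⟩ J) d → faceDepth J x ≤ η) :
    cubeDepth d c x ≤ η := by
  refine Finset.sup_le fun J _ => ?_
  split_ifs with hJ
  · exact h J hJ
  · exact unitInterval.nonneg'

theorem exists_le_faceDepth {d : X.Cube} {n : ℕ} {c : X.cube n} {x : Fin n → I} {η : I}
    (hη : 0 < η) (h : η ≤ cubeDepth d c x) :
    ∃ J, X.IsIterFace (X.iterFace ⟨n, c⟩ J) d ∧ η ≤ faceDepth J x := by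
  rw [cubeDepth, Finset.le_sup_iff (by exact hη)] at h
  obtain ⟨J, -, hJ⟩ := h
  split_ifs at hJ with hd
  · exact ⟨J, hd, hJ⟩
  · exact absurd hη hJ.not_gt

theorem continuous_cubeDepth (d : X.Cube) {n : ℕ} (c : X.cube n) :
    Continuous (cubeDepth d c) := by
  refine Continuous.finset_sup_apply fun J _ => ?_
  split_ifs
  · exact Continuous.finset_inf_apply fun i _ => (continuous_depth _).comp (continuous_apply i)
  · exact continuous_const

theorem cubeDepth_face (d : X.Cube) {n : ℕ} (α : Bool) (i : Fin (n + 1)) (c : X.cube (n + 1))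
    (x : Fin n → I) :
    cubeDepth d c (i.insertNth (α := fun _ => I) (endpoint α) x) =
      cubeDepth d (X.face α i c) x := by
  refine le_antisymm (cubeDepth_le fun J hJ => ?_) (cubeDepth_le fun J hJ => ?_)
  · obtain ⟨a, J, rfl⟩ : ∃ a J', J = i.insertNth (α := fun _ => Option Bool) a J' :=
      ⟨_, _, (Fin.insertNth_self_removeNth i J).symm⟩
    rw [faceDepth_insertNth]
    by_cases ha : a = some !α
    · rw [ha, depth_some_not_endpoint]
      exact inf_le_left.trans unitInterval.nonneg'
    · refine inf_le_right.trans (faceDepth_le_cubeDepth ?_ x)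
      rw [← iterFace_insertNth]
      refine (isIterFace_iterFace_of_le ⟨n + 1, c⟩ fun k γ hk => ?_).trans hJ
      cases k using Fin.succAboveCases i with
      | x =>
        simp only [Fin.insertNth_apply_same] at hk ⊢
        subst hk
        cases α <;> cases γ <;> simp_all
      | p k => simpa using hk
  · rw [← iterFace_insertNth] at hJ
    refine le_trans ?_ (faceDepth_le_cubeDepth hJ _)
    rw [faceDepth_insertNth, depth_some_endpoint]
    exact le_inf unitInterval.le_one' le_rfl

/-- A continuous function on `|X|` that is positive on the collar of `d`. -/
noncomputable def collarDepth (d : X.Cube) : C(X.Realization, I) :=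
  desc (cubeDepth d) (continuous_cubeDepth d) (cubeDepth_face d)

theorem mem_collar {d : X.Cube} {z : X.Realization} :
    z ∈ X.collar d ↔ ∃ (c : X.Cube) (J : Fin c.1 → Option Bool),
      X.IsIterFace (X.iterFace c J) d ∧ ∃ x ∈ cubeCollar J, X.point c x = z := by
  simp only [collar, Set.mem_iUnion, Set.mem_image, exists_prop]

theorem collarDepth_pos {d : X.Cube} {z : X.Realization} (hz : z ∈ X.collar d) :
    0 < collarDepth d z := by
  obtain ⟨c, J, hJ, x, hx, rfl⟩ := mem_collar.1 hz
  refine lt_of_lt_of_le ?_ (faceDepth_le_cubeDepth hJ x)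
  exact (Finset.lt_inf_iff (show (0 : I) < 1 from zero_lt_one)).2
    fun i _ => depth_pos (hx i).1 (hx i).2

theorem point_mem_collar (c : X.Cube) (x : Fin c.1 → I) : X.point c x ∈ X.collar c :=
  mem_collar.2 ⟨c, fun _ => none, (iterFace_none c).symm ▸ IsIterFace.refl c, x, fun i => by simp,
    rfl⟩

theorem vertex_mem_star (v : X.cube 0) : X.vertex v ∈ X.star v :=
  point_mem_collar _ _

/-! ### Dilations -/

theorem eq_or_eq_endpoint_of_projIcc_eq {a b u v : ℝ} {hab : a ≤ b}
    (h : Set.projIcc a b hab u = Set.projIcc a b hab v) :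
    u = v ∨ Set.projIcc a b hab u = ⟨a, Set.left_mem_Icc.2 hab⟩ ∨
      Set.projIcc a b hab u = ⟨b, Set.right_mem_Icc.2 hab⟩ := by
  rcases le_or_gt u a with hu | hau
  · exact Or.inr (Or.inl (Set.projIcc_of_le_left hab hu))
  rcases le_or_gt b u with hu | hub
  · exact Or.inr (Or.inr (Set.projIcc_of_right_le hab hu))
  rcases le_or_gt v a with hv | hav
  · exact Or.inr (Or.inl (h.trans (Set.projIcc_of_le_left hab hv)))
  rcases le_or_gt b v with hv | hvb
  · exact Or.inr (Or.inr (h.trans (Set.projIcc_of_right_le hab hv)))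
  exact Or.inl ((Set.strictMonoOn_projIcc _).injOn ⟨hau.le, hub.le⟩ ⟨hav.le, hvb.le⟩ h)

/-- The dilation of the unit interval with centre `1/2` and factor `max 1 κ`, truncated. -/
noncomputable def stretch (κ : ℝ) (x : I) : I :=
  Set.projIcc 0 1 zero_le_one (1 / 2 + max 1 κ * (x - 1 / 2 : ℝ))

theorem continuous_stretch : Continuous fun a : I × ℝ => stretch a.2 a.1 :=
  continuous_projIcc.comp (by fun_prop)

theorem stretch_endpoint (κ : ℝ) (α : Bool) : stretch κ (endpoint α) = endpoint α := by
  have := le_max_left 1 κ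
  cases α
  · exact Set.projIcc_of_le_left zero_le_one (by rw [endpoint, Set.Icc.coe_zero]; linarith)
  · exact Set.projIcc_of_right_le zero_le_one (by rw [endpoint, Set.Icc.coe_one]; linarith)

theorem stretch_inv_of_le_depth {η x : I} {α : Bool} (hη : 0 < η)
    (h : η ≤ depth (some α) x) : stretch (η : ℝ)⁻¹ x = endpoint α := by
  have hη' : (0 : ℝ) < η := hη
  have hinv : (1 : ℝ) ≤ (η : ℝ)⁻¹ := (one_le_inv₀ hη').2 η.2.2
  have hmul : (η : ℝ)⁻¹ * η = 1 := inv_mul_cancel₀ hη'.ne'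
  rw [le_depth_some_iff hη] at h
  rw [stretch, max_eq_right hinv]
  cases α
  · rw [endpoint, Set.Icc.coe_zero, sub_zero, abs_of_nonneg x.2.1] at h
    exact Set.projIcc_of_le_left zero_le_one (by nlinarith)
  · rw [endpoint, Set.Icc.coe_one, abs_of_nonpos (sub_nonpos.2 x.2.2)] at h
    exact Set.projIcc_of_right_le zero_le_one (by nlinarith)

theorem stretch_one (x : I) : stretch 1 x = x := by
  rw [stretch, max_self, one_mul, add_sub_cancel, Set.projIcc_val]

theorem stretch_mono (κ : ℝ) : Monotone (stretch κ) := by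
  intro x y hxy
  have hxy' : (x : ℝ) ≤ y := hxy
  have := le_max_left 1 κ
  exact Set.monotone_projIcc _ (by gcongr)

theorem eq_or_eq_endpoint_of_stretch_eq {κ : ℝ} {x y : I} (h : stretch κ x = stretch κ y) :
    x = y ∨ stretch κ x = 0 ∨ stretch κ x = 1 := by
  have hκ : max 1 κ ≠ 0 := (lt_max_of_lt_left one_pos).ne'
  refine (eq_or_eq_endpoint_of_projIcc_eq h).imp_left fun hxy => Subtype.ext ?_
  exact sub_left_inj.1 (mul_left_cancel₀ hκ (add_left_cancel hxy))

theorem stretch_lt_half {κ : ℝ} {x : I} (h : (x : ℝ) < 1 / 2) : (stretch κ x : ℝ) < 1 / 2 := by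
  have := le_max_left 1 κ
  rw [stretch, Set.coe_projIcc]
  exact max_lt (by norm_num) (min_lt_of_right_lt (by nlinarith))

theorem half_lt_stretch {κ : ℝ} {x : I} (h : 1 / 2 < (x : ℝ)) : 1 / 2 < (stretch κ x : ℝ) := by
  have := le_max_left 1 κ
  rw [stretch, Set.coe_projIcc]
  exact lt_max_of_lt_right (lt_min (by norm_num) (by nlinarith))

/-- The coordinatewise dilations of `|X|`, as a family of paths in `|X|`. It is through the
currying that joint continuity in the factor and the point passes to the quotient `|X|`. -/
noncomputable def dilateMap : C(X.Realization, C(ℝ, X.Realization)) :=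
  desc (fun {n} c => ContinuousMap.curry
      ⟨fun a : (Fin n → I) × ℝ => X.point ⟨n, c⟩ fun i => stretch a.2 (a.1 i),
        (continuous_point ⟨n, c⟩).comp (continuous_pi fun i => continuous_stretch.comp
          (f := fun a : (Fin _ → I) × ℝ => (a.1 i, a.2)) (by fun_prop))⟩)
    (fun _ => ContinuousMap.continuous _)
    (fun α i c x => by
      ext κ
      change X.point _ _ = X.point _ _
      rw [point_face]
      congr 1
      rw [Fin.eq_insertNth_iff]
      exact ⟨by simp [stretch_endpoint], funext fun k => by simp [Fin.removeNth]⟩)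

/-- The coordinatewise dilation of `|X|` with factor `max 1 κ`. -/
noncomputable def dilate (κ : ℝ) (z : X.Realization) : X.Realization :=
  dilateMap z κ

theorem dilate_point (κ : ℝ) (c : X.Cube) (x : Fin c.1 → I) :
    dilate κ (X.point c x) = X.point c fun i => stretch κ (x i) := rfl

theorem continuous_dilate : Continuous fun a : ℝ × X.Realization => dilate a.1 a.2 :=
  Continuous.eval (dilateMap.continuous.comp continuous_snd) continuous_fst

theorem dilate_one (z : X.Realization) : dilate 1 z = z := by
  obtain ⟨c, x, rfl⟩ := exists_point_eq z
  simp only [dilate_point, stretch_one]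

theorem dilate_vertex (κ : ℝ) (v : X.cube 0) : dilate κ (X.vertex v) = X.vertex v :=
  eq_vertex_of_mem_range ⟨_, rfl⟩

theorem dilate_mem_collar {d : X.Cube} {z : X.Realization} (κ : ℝ) (hz : z ∈ X.collar d) :
    dilate κ z ∈ X.collar d := by
  obtain ⟨c, J, hJ, x, hx, rfl⟩ := mem_collar.1 hz
  exact mem_collar.2 ⟨c, J, hJ, _, fun i => ⟨fun h => stretch_lt_half ((hx i).1 h),
    fun h => half_lt_stretch ((hx i).2 h)⟩, rfl⟩

theorem dilate_mem_range_point {d : X.Cube} {z : X.Realization} {η : I} (hη : 0 < η)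
    (hz : η ≤ collarDepth d z) : dilate (η : ℝ)⁻¹ z ∈ Set.range (X.point d) := by
  obtain ⟨c, x, rfl⟩ := exists_point_eq z
  obtain ⟨J, hJ, hdepth⟩ := exists_le_faceDepth hη hz
  have hface : OnFace J fun i => stretch (η : ℝ)⁻¹ (x i) := fun i α hα =>
    stretch_inv_of_le_depth hη (hα ▸ Finset.le_inf_iff.1 hdepth i (Finset.mem_univ i))
  rw [dilate_point, ← point_iterFace_comp_freeIndex hface]
  exact hJ.point_mem_range _

/-! ### Finite monotone covers of an interval -/

theorem exists_mem_Icc_succ {α : Type*} [LinearOrder α] {n : ℕ} (hn : 0 < n)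
    (τ : Fin (n + 1) → α) {v : α} (hfirst : τ 0 ≤ v) (hlast : v ≤ τ (Fin.last n)) :
    ∃ i : Fin n, v ∈ Set.Icc (τ i.castSucc) (τ i.succ) := by
  obtain ⟨m, rfl⟩ : ∃ m, n = m + 1 := ⟨n - 1, by omega⟩
  by_contra! hnot
  have hle (k : Fin (m + 2)) : τ k ≤ v := by
    induction k using Fin.induction with
    | zero => exact hfirst
    | succ k ih => exact (not_le.1 fun h => hnot k ⟨ih, h⟩).le
  exact hnot (Fin.last m) ⟨hle _, hlast⟩

/-- Otherwise each value `y` between `f b` and `f a` has a last time `s y`. Infinitely many `y`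
share a member of the cover containing `s y`, while `s` reverses the order. -/
theorem le_of_finite_monotoneOn_cover {ι : Type*} [Finite ι] {f : I → ℝ} {a b : I} (hab : a ≤ b)
    (hf : Continuous f) (T : ι → Set I) (hT : ∀ t ∈ Set.Icc a b, ∃ i, t ∈ T i)
    (hmono : ∀ i, MonotoneOn f (T i)) : f a ≤ f b := by
  by_contra! hlt
  have hlast : ∀ y ∈ Set.Ioo (f b) (f a), ∃ s ∈ Set.Icc a b, f s = y ∧
      ∀ t ∈ Set.Icc a b, y ≤ f t → t ≤ s := by
    intro y hy
    have hcompact : IsCompact (Set.Icc a b ∩ {t | y ≤ f t}) :=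
      isCompact_Icc.inter_right (isClosed_le continuous_const hf)
    obtain ⟨s, ⟨hs, hys⟩, hmax⟩ := hcompact.exists_isGreatest ⟨a, ⟨le_rfl, hab⟩, hy.2.le⟩
    obtain ⟨t, ht, hft⟩ := intermediate_value_Icc' hs.2 hf.continuousOn ⟨hy.1.le, hys⟩
    have hts : t ≤ s := hmax ⟨⟨hs.1.trans ht.1, ht.2⟩, hft.ge⟩
    obtain rfl : t = s := le_antisymm hts ht.1
    exact ⟨t, hs, hft, fun t' ht' hyt' => hmax ⟨ht', hyt'⟩⟩
  choose! s hs hfs hmax using hlast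
  have : Nonempty ι := (hT a ⟨le_rfl, hab⟩).nonempty
  choose! i hi using hT
  have : Infinite (Set.Ioo (f b) (f a)) := (Set.Ioo_infinite hlt).to_subtype
  obtain ⟨y, y', hne, hi_eq⟩ := Finite.exists_ne_map_eq_of_infinite
    fun y : Set.Ioo (f b) (f a) => i (s y)
  wlog hyy' : y < y' generalizing y y'
  · exact this y' y hne.symm hi_eq.symm (lt_of_le_of_ne (not_lt.1 hyy') hne.symm)
  have hss' : s y' ≤ s y := hmax y y.2 _ (hs y' y'.2) (by rw [hfs y' y'.2]; exact hyy'.le)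
  have hle := hmono (i (s y)) (hi_eq ▸ hi _ (hs y' y'.2)) (hi _ (hs y y.2)) hss'
  rw [hfs y y.2, hfs y' y'.2] at hle
  exact absurd hyy' hle.not_gt

/-! ### Presentations -/

theorem IsIterFace.monotone_coords_point (hX : X.IsNonSelfLinked) {d c : X.Cube}
    (h : X.IsIterFace d c) : Monotone fun z => coords c (X.point d z) := by
  obtain ⟨J, rfl⟩ := h
  simpa only [← point_faceInclusion, hX.coords_point] using faceInclusion_mono c J

namespace Presentation

variable {p : C(I, X.Realization)} (P : X.Presentation p)

theorem len_pos : 0 < P.len := by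
  by_contra hlen
  have hlast : Fin.last P.len = 0 := Fin.ext (by simp only [Fin.val_last, Fin.val_zero]; omega)
  exact zero_ne_one (P.time_zero.symm.trans (hlast ▸ P.time_last))

theorem exists_mem_Icc (t : I) : ∃ i : Fin P.len, t ∈ Set.Icc (P.time i.castSucc) (P.time i.succ) :=
  exists_mem_Icc_succ P.len_pos P.time (P.time_zero ▸ unitInterval.nonneg')
    (P.time_last ▸ unitInterval.le_one')

theorem time_le (i : Fin P.len) : P.time i.castSucc ≤ P.time i.succ :=
  P.time_mono i.castSucc_lt_succ.le

theorem time_succ_le {i j : Fin P.len} (h : i < j) : P.time i.succ ≤ P.time j.castSucc :=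
  P.time_mono (Fin.succ_le_castSucc_iff.2 h)

end Presentation

/-- As `p` may follow different faces of `c` within a single cube of the presentation, the domain
is covered by the sets on which `p` runs in a given face of a given cube of the presentation. -/
theorem Presentation.coords_le (hX : X.IsNonSelfLinked) {p : C(I, X.Realization)}
    (P : X.Presentation p) {c : X.Cube} {a b : I} (hab : a ≤ b)
    (hp : ∀ t ∈ Set.Icc a b, p t ∈ Set.range (X.point c)) : coords c (p a) ≤ coords c (p b) := by
  intro j
  have hcont : Continuous fun t => (coords c (p t) j : ℝ) :=
    continuous_subtype_val.comp
      ((continuous_apply j).comp ((continuous_coords c).comp p.continuous))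
  refine le_of_finite_monotoneOn_cover (f := fun t => (coords c (p t) j : ℝ)) hab hcont
    (fun f : Σ i, Fin (P.cube i).1 → Option Bool =>
      {t | t ∈ Set.Icc (P.time f.1.castSucc) (P.time f.1.succ) ∧
        OnFace f.2 (P.coord f.1 t) ∧ X.IsIterFace (X.iterFace (P.cube f.1) f.2) c})
    (fun t ht => ?_) ?_
  · obtain ⟨i, hi⟩ := P.exists_mem_Icc t
    obtain ⟨y, hy⟩ := hp t ht
    refine ⟨⟨i, minFace (P.coord i t)⟩, hi, onFace_minFace _, ?_⟩
    rw [← carrier_point, ← P.eq_point i t hi, ← hy, carrier_point]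
    exact ⟨_, rfl⟩
  · rintro ⟨i, J⟩ s ⟨hs, hsJ, hJ⟩ t ⟨ht, htJ, -⟩ hst
    dsimp only at hs ht hsJ htJ hJ ⊢
    rw [P.eq_point i s hs, P.eq_point i t ht, ← point_iterFace_comp_freeIndex hsJ,
      ← point_iterFace_comp_freeIndex htJ]
    exact hJ.monotone_coords_point hX (fun k => P.monotoneOn i hs ht hst _) j

/-! ### Lengths -/

theorem eq_of_le_of_sum_eq {n : ℕ} {x y : Fin n → I} (hxy : x ≤ y)
    (hsum : ∑ k, (x k : ℝ) = ∑ k, (y k : ℝ)) : x = y :=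
  funext fun k => Subtype.ext <|
    (Finset.sum_eq_sum_iff_of_le (f := fun i => (x i : ℝ)) (g := fun i => (y i : ℝ))
      fun i _ => hxy i).1 hsum k (Finset.mem_univ k)

theorem eq_zero_of_sum_eq_zero {n : ℕ} {x : Fin n → I} (h : ∑ k, (x k : ℝ) = 0) : x = 0 :=
  (eq_of_le_of_sum_eq (fun _ => unitInterval.nonneg') (by simpa using h.symm)).symm

theorem eq_one_of_sum_eq {n : ℕ} {x : Fin n → I} (h : ∑ k, (x k : ℝ) = n) : x = 1 :=
  eq_of_le_of_sum_eq (fun _ => unitInterval.le_one') (by simpa using h)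

/-- The total dimension of the first `i` cubes of a sequence. -/
def partialDim {n : ℕ} (f : Fin n → X.Cube) (i : ℕ) : ℝ :=
  ∑ j : Fin n, if (j : ℕ) < i then ((f j).1 : ℝ) else 0

section partialDim

variable {n : ℕ} (f : Fin n → X.Cube)

theorem partialDim_zero : partialDim f 0 = 0 := by simp [partialDim]

theorem partialDim_succ (i : Fin n) : partialDim f (i + 1) = partialDim f i + (f i).1 := by
  have hsplit (j : Fin n) : (if (j : ℕ) < i + 1 then ((f j).1 : ℝ) else 0) =
      (if (j : ℕ) < i then ((f j).1 : ℝ) else 0) + if j = i then ((f j).1 : ℝ) else 0 := by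
    rcases lt_trichotomy j i with h | rfl | h
    · simp [Fin.lt_def.1 h, Nat.lt_succ_of_lt (Fin.lt_def.1 h), h.ne]
    · simp
    · simp [not_lt.2 h.le, not_lt.2 (Nat.succ_le_of_lt (Fin.lt_def.1 h)), h.ne']
  rw [partialDim, Finset.sum_congr rfl fun j _ => hsplit j, Finset.sum_add_distrib,
    Finset.sum_ite_eq' Finset.univ i, if_pos (Finset.mem_univ i), partialDim]

theorem partialDim_mono : Monotone (partialDim f) := by
  intro i i' h
  refine Finset.sum_le_sum fun j _ => ?_
  split_ifs
  · exact le_rfl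
  · omega
  · positivity
  · exact le_rfl

theorem partialDim_nonneg (i : ℕ) : 0 ≤ partialDim f i :=
  (partialDim_zero f).ge.trans (partialDim_mono f i.zero_le)

theorem partialDim_lt (hf : ∀ i, 0 < (f i).1) {i j : ℕ} (hij : i < j) (hi : i < n) :
    partialDim f i < partialDim f j := by
  refine lt_of_lt_of_le ?_ (partialDim_mono f (Nat.succ_le_of_lt hij))
  rw [Nat.succ_eq_add_one, partialDim_succ f ⟨i, hi⟩]
  exact lt_add_of_pos_right _ (Nat.cast_pos.2 (hf _))

theorem coe_partialDim (i : ℕ) : (partialDim f i : AddCircle (1 : ℝ)) = 0 :=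
  (AddCircle.coe_eq_zero_iff 1).2
    ⟨∑ j : Fin n, if (j : ℕ) < i then ((f j).1 : ℤ) else 0, by simp [partialDim]⟩

theorem exists_partialDim_le (hn : 0 < n) {v : ℝ} (hv : 0 ≤ v) (hv' : v ≤ partialDim f n) :
    ∃ i : Fin n, partialDim f i ≤ v ∧ v ≤ partialDim f (i + 1) :=
  exists_mem_Icc_succ hn (fun k : Fin (n + 1) => partialDim f k)
    (by simpa only [Fin.val_zero, partialDim_zero] using hv)
    (by simpa only [Fin.val_last] using hv')

end partialDim

/-- `ℓ` increases continuously from `0` to `N`. -/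
structure IsSchedule (N : ℝ) (ℓ : I → ℝ) : Prop where
  continuous : Continuous ℓ
  monotone : Monotone ℓ
  zero : ℓ 0 = 0
  one : ℓ 1 = N

namespace IsSchedule

variable {N : ℝ} {ℓ ℓ' : I → ℝ}

theorem nonneg (h : IsSchedule N ℓ) (t : I) : 0 ≤ ℓ t :=
  h.zero.symm.le.trans (h.monotone unitInterval.nonneg')

theorem le (h : IsSchedule N ℓ) (t : I) : ℓ t ≤ N :=
  (h.monotone unitInterval.le_one').trans h.one.le

theorem mul_coe (hN : 0 ≤ N) : IsSchedule N fun t => N * t where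
  continuous := by fun_prop
  monotone _ _ h := mul_le_mul_of_nonneg_left h hN
  zero := by simp
  one := by simp

theorem convex (h : IsSchedule N ℓ) (h' : IsSchedule N ℓ') (s : I) :
    IsSchedule N fun t => (1 - s) * ℓ t + s * ℓ' t where
  continuous := by have := h.continuous; have := h'.continuous; fun_prop
  monotone _ _ ht := add_le_add (mul_le_mul_of_nonneg_left (h.monotone ht) (sub_nonneg.2 s.2.2))
    (mul_le_mul_of_nonneg_left (h'.monotone ht) s.2.1)
  zero := by simp [h.zero, h'.zero]
  one := by simp only [h.one, h'.one]; ring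

end IsSchedule

/-- The path `p` runs through the cubes of the sequence `f`, and `ℓ t` is the `ℓ¹`-distance that
it has covered at time `t`. -/
structure IsLength (p : C(I, X.Realization)) {n : ℕ} (f : Fin n → X.Cube) (ℓ : I → ℝ) : Prop
    extends IsSchedule (partialDim f n) ℓ where
  lifts : ∀ t, (ℓ t : AddCircle (1 : ℝ)) = phase (p t)
  follows : ∀ (i : Fin n) (t : I), partialDim f i ≤ ℓ t → ℓ t ≤ partialDim f (i + 1) →
    ∃ x, p t = X.point (f i) x ∧ ∑ k, (x k : ℝ) = ℓ t - partialDim f i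

theorem IsLength.unique {p : C(I, X.Realization)} {n m : ℕ} {f : Fin n → X.Cube}
    {g : Fin m → X.Cube} {ℓ ℓ' : I → ℝ} (h : IsLength p f ℓ) (h' : IsLength p g ℓ') : ℓ = ℓ' :=
  (AddCircle.isCoveringMap_coe (1 : ℝ)).eq_of_comp_eq h.continuous h'.continuous
    (funext fun t => (h.lifts t).trans (h'.lifts t).symm) 0 (h.zero.trans h'.zero.symm)

namespace Presentation

variable {p : C(I, X.Realization)} (P : X.Presentation p)

/-- Each coordinate path runs from the bottom to the top vertex of its cube. -/
def IsFull : Prop :=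
  ∀ i, P.coord i (P.time i.castSucc) = 0 ∧ P.coord i (P.time i.succ) = 1

/-- The `i`-th coordinate path, extended to a path that is constant before and after its own time
interval. -/
noncomputable def extendCoord (i : Fin P.len) : I → Fin (P.cube i).1 → I :=
  Set.IccExtend (P.time_le i) (Set.domRestrict _ (P.coord i))

theorem continuous_extendCoord (i : Fin P.len) : Continuous (P.extendCoord i) :=
  (P.continuousOn i).domRestrict.Icc_extend'

theorem extendCoord_mono (i : Fin P.len) : Monotone (P.extendCoord i) :=
  Monotone.IccExtend _ fun s t hst => P.monotoneOn i s.2 t.2 hst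

/-- The `ℓ¹`-length of the coordinate paths up to time `t`, provided they start at `0`. -/
noncomputable def length (t : I) : ℝ := ∑ i, ∑ k, (P.extendCoord i t k : ℝ)

theorem continuous_length : Continuous P.length := by
  have := P.continuous_extendCoord
  unfold length
  fun_prop

theorem length_mono : Monotone P.length := fun _ _ hst =>
  Finset.sum_le_sum fun i _ => Finset.sum_le_sum fun k _ => P.extendCoord_mono i hst k

theorem IsFull.length_eq {P : X.Presentation p} (hP : P.IsFull) {i : Fin P.len} {t : I}
    (ht : t ∈ Set.Icc (P.time i.castSucc) (P.time i.succ)) :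
    P.length t = partialDim P.cube i + ∑ k, (P.coord i t k : ℝ) := by
  have hterm (j : Fin P.len) : ∑ k, (P.extendCoord j t k : ℝ) =
      (if (j : ℕ) < i then ((P.cube j).1 : ℝ) else 0) +
        if j = i then ∑ k, (P.coord i t k : ℝ) else 0 := by
    rcases lt_trichotomy j i with hj | rfl | hj
    · rw [extendCoord, Set.IccExtend_of_right_le _ _ ((P.time_succ_le hj).trans ht.1),
        Set.domRestrict_apply, (hP j).2, if_pos (Fin.lt_def.1 hj), if_neg hj.ne]
      simp
    · rw [extendCoord, Set.IccExtend_of_mem _ _ ht, if_neg (lt_irrefl _), if_pos rfl, zero_add]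
      rfl
    · rw [extendCoord, Set.IccExtend_of_le_left _ _ (ht.2.trans (P.time_succ_le hj)),
        Set.domRestrict_apply, (hP j).1, if_neg (not_lt.2 (Fin.lt_def.1 hj).le), if_neg hj.ne']
      simp
  rw [length, Finset.sum_congr rfl fun j _ => hterm j, Finset.sum_add_distrib, ← partialDim,
    Finset.sum_ite_eq' Finset.univ i, if_pos (Finset.mem_univ i)]

theorem IsFull.length_castSucc {P : X.Presentation p} (hP : P.IsFull) (i : Fin P.len) :
    P.length (P.time i.castSucc) = partialDim P.cube i := by
  rw [hP.length_eq (Set.left_mem_Icc.2 (P.time_le i)), (hP i).1]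
  simp

theorem IsFull.length_succ {P : X.Presentation p} (hP : P.IsFull) (i : Fin P.len) :
    P.length (P.time i.succ) = partialDim P.cube (i + 1) := by
  rw [hP.length_eq (Set.right_mem_Icc.2 (P.time_le i)), (hP i).2, partialDim_succ]
  simp

theorem IsFull.length_time {P : X.Presentation p} (hP : P.IsFull) (k : Fin (P.len + 1)) :
    P.length (P.time k) = partialDim P.cube k := by
  cases k using Fin.lastCases with
  | cast i => exact hP.length_castSucc i
  | last =>
    have hlast : Fin.last P.len = (⟨P.len - 1, Nat.sub_lt P.len_pos one_pos⟩ : Fin P.len).succ :=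
      Fin.ext (Nat.sub_add_cancel P.len_pos).symm
    rw [hlast, hP.length_succ, Fin.val_succ]

theorem IsFull.isSchedule_length {P : X.Presentation p} (hP : P.IsFull) :
    IsSchedule (partialDim P.cube P.len) P.length where
  continuous := P.continuous_length
  monotone := P.length_mono
  zero := by rw [← P.time_zero, hP.length_time, Fin.val_zero, partialDim_zero]
  one := by rw [← P.time_last, hP.length_time, Fin.val_last]

theorem IsFull.eq_of_length_eq {P : X.Presentation p} (hP : P.IsFull)
    (hdim : ∀ i, 0 < (P.cube i).1) {t t' : I} (h : P.length t = P.length t') : p t = p t' := by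
  wlog htt' : t ≤ t' generalizing t t'
  · exact (this h.symm (not_le.1 htt').le).symm
  have eq_of_mem {i : Fin P.len} {s s' : I} (hs : s ∈ Set.Icc (P.time i.castSucc) (P.time i.succ))
      (hs' : s' ∈ Set.Icc (P.time i.castSucc) (P.time i.succ)) (hss' : s ≤ s')
      (h : P.length s = P.length s') : p s = p s' := by
    rw [hP.length_eq hs, hP.length_eq hs', add_right_inj] at h
    rw [P.eq_point i s hs, P.eq_point i s' hs', eq_of_le_of_sum_eq (P.monotoneOn i hs hs' hss') h]
  obtain ⟨i, hi⟩ := P.exists_mem_Icc t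
  obtain ⟨j, hj⟩ := P.exists_mem_Icc t'
  rcases lt_trichotomy i j with hij | rfl | hji
  · have hle : partialDim P.cube j ≤ partialDim P.cube (i + 1) := by
      rw [← hP.length_castSucc, ← hP.length_succ]
      exact (P.length_mono hj.1).trans (h.symm.le.trans (P.length_mono hi.2))
    have hsucc : i.succ = j.castSucc := by
      refine Fin.ext (le_antisymm hij (not_lt.1 fun hlt => hle.not_gt ?_))
      exact partialDim_lt _ hdim hlt (hlt.trans j.2)
    have hmem : P.time j.castSucc ∈ Set.Icc (P.time i.castSucc) (P.time i.succ) := by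
      rw [← hsucc]; exact Set.right_mem_Icc.2 (P.time_le i)
    have hle' : t ≤ P.time j.castSucc := hi.2.trans (P.time_succ_le hij)
    have hlen : P.length t = P.length (P.time j.castSucc) :=
      le_antisymm (P.length_mono hle') ((P.length_mono hj.1).trans h.symm.le)
    exact (eq_of_mem hi hmem hle' hlen).trans
      (eq_of_mem (Set.left_mem_Icc.2 (P.time_le j)) hj hj.1 (hlen.symm.trans h))
  · exact eq_of_mem hi hj htt' h
  · rw [le_antisymm htt' (hj.2.trans ((P.time_succ_le hji).trans hi.1))]

theorem IsFull.isLength {P : X.Presentation p} (hP : P.IsFull) (hdim : ∀ i, 0 < (P.cube i).1) :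
    IsLength p P.cube P.length where
  toIsSchedule := hP.isSchedule_length
  lifts t := by
    obtain ⟨i, hi⟩ := P.exists_mem_Icc t
    rw [hP.length_eq hi, P.eq_point i t hi, phase_point, AddCircle.coe_add, coe_partialDim,
      zero_add]
  follows i t hit hti := by
    rw [← hP.length_castSucc] at hit
    rw [← hP.length_succ] at hti
    obtain ⟨t', ht', hlen⟩ := intermediate_value_Icc (P.time_le i) P.continuous_length.continuousOn
      ⟨hit, hti⟩
    refine ⟨P.coord i t', ?_, ?_⟩
    · rw [← hP.eq_of_length_eq hdim hlen, P.eq_point i t' ht']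
    · rw [← hlen, hP.length_eq ht', add_sub_cancel_left]

end Presentation

/-! ### Tame paths and coordinate tracks -/

theorem Presentation.IsFull.apply_time_castSucc {p : C(I, X.Realization)} {P : X.Presentation p}
    (hP : P.IsFull) (i : Fin P.len) : p (P.time i.castSucc) = X.vertex (X.source (P.cube i)) := by
  rw [P.eq_point i _ (Set.left_mem_Icc.2 (P.time_le i)), (hP i).1, point_zero]

theorem Presentation.IsFull.apply_time_succ {p : C(I, X.Realization)} {P : X.Presentation p}
    (hP : P.IsFull) (i : Fin P.len) : p (P.time i.succ) = X.vertex (X.target (P.cube i)) := by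
  rw [P.eq_point i _ (Set.right_mem_Icc.2 (P.time_le i)), (hP i).2, point_one]

variable {x y : X.cube 0}

theorem Presentation.IsFull.mem_tameSub {p : C(I, X.Realization)} {P : X.Presentation p}
    (hP : P.IsFull) {c : X.CubeChain x y} (hcubes : List.ofFn P.cube = c.cubes) :
    p ∈ c.tameSub := by
  have hsource : p 0 = X.vertex x := by
    have hx := c.source_head
    simp only [← hcubes, List.head_ofFn] at hx
    rw [← hx, ← hP.apply_time_castSucc, ← P.time_zero]
    rfl
  have htarget : p 1 = X.vertex y := by
    have hy := c.target_last
    simp only [← hcubes, List.getLast_ofFn] at hy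
    rw [← hy, ← hP.apply_time_succ, ← P.time_last]
    exact congrArg _ (congrArg _ (Fin.ext (Nat.sub_add_cancel P.len_pos).symm))
  refine ⟨⟨⟨hsource, htarget, ⟨P⟩⟩, P, fun k => ?_⟩, P, hcubes, hP⟩
  cases k using Fin.cases with
  | zero => exact ⟨x, by rw [P.time_zero, hsource]⟩
  | succ i => exact ⟨_, hP.apply_time_succ i⟩

namespace CubeChain

theorem length_pos (c : X.CubeChain x y) : 0 < c.cubes.length :=
  List.length_pos_of_ne_nil c.ne_nil

theorem dim_get_pos (c : X.CubeChain x y) (i : Fin c.cubes.length) : 0 < (c.cubes.get i).1 :=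
  c.dim_pos _ (List.get_mem _ _)

theorem target_get (c : X.CubeChain x y) {i j : Fin c.cubes.length} (h : (j : ℕ) = i + 1) :
    X.target (c.cubes.get i) = X.source (c.cubes.get j) := by
  have hj : (i : ℕ) + 1 < c.cubes.length := h ▸ j.2
  obtain rfl : j = ⟨i + 1, hj⟩ := Fin.ext h
  exact List.isChain_iff_getElem.1 c.isChain i hj

/-- The total dimension of the first `i` cubes of a cube chain. -/
abbrev position (c : X.CubeChain x y) (i : ℕ) : ℝ := partialDim c.cubes.get i

theorem strictMono_position (c : X.CubeChain x y) :
    StrictMono fun k : Fin (c.cubes.length + 1) => c.position k := fun _ k' h =>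
  partialDim_lt _ c.dim_get_pos h (lt_of_lt_of_le h (Fin.is_le k'))

theorem exists_isLength (c : X.CubeChain x y) {p : C(I, X.Realization)} (hp : p ∈ c.tameSub) :
    ∃ ℓ, IsLength p c.cubes.get ℓ := by
  obtain ⟨-, P, hcubes, hP⟩ := hp
  have hdim (i : Fin P.len) : 0 < (P.cube i).1 :=
    c.dim_pos _ (hcubes ▸ List.mem_ofFn.2 ⟨i, rfl⟩)
  have hcubes' : (⟨P.len, P.cube⟩ : Σ n, Fin n → X.Cube) = ⟨_, c.cubes.get⟩ :=
    List.ofFn_inj'.1 (by rw [hcubes, List.ofFn_get])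
  have hlength : ∃ ℓ, IsLength p (⟨P.len, P.cube⟩ : Σ n, Fin n → X.Cube).2 ℓ :=
    ⟨_, Presentation.IsFull.isLength (P := P) hP hdim⟩
  rwa [hcubes'] at hlength

/-- The points whose position `v` along the cube chain lies in the `i`-th cube. -/
def stage (c : X.CubeChain x y) {Z : Type*} (v : Z → ℝ) (i : ℕ) : Set Z :=
  {z | c.position i ≤ v z ∧ v z ≤ c.position (i + 1)}

theorem exists_mem_stage (c : X.CubeChain x y) {Z : Type*} {v : Z → ℝ} {z : Z} (hz : 0 ≤ v z)
    (hz' : v z ≤ c.position c.cubes.length) : ∃ i : Fin c.cubes.length, z ∈ c.stage v i :=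
  exists_partialDim_le _ c.length_pos hz hz'

/-- A family of coordinates `B i z` in the cubes of `c`, compatible at the common vertices of
consecutive cubes; `v z` is the position of the parameter `z` along `c`, so that `B i z` matters
only for `z` in the `i`-th stage. -/
structure IsTrack (c : X.CubeChain x y) {Z : Type*} [TopologicalSpace Z] (v : Z → ℝ)
    (B : ∀ i : Fin c.cubes.length, Z → Fin (c.cubes.get i).1 → I) : Prop where
  continuous : ∀ i, Continuous (B i)
  eq_zero : ∀ (i : Fin c.cubes.length) z, v z = c.position i → B i z = 0
  eq_one : ∀ (i : Fin c.cubes.length) z, v z = c.position (i + 1) → B i z = 1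

/-- The map `q` is given, on each stage, by the coordinates `B`. -/
def Follows (c : X.CubeChain x y) {Z : Type*} (v : Z → ℝ)
    (B : ∀ i : Fin c.cubes.length, Z → Fin (c.cubes.get i).1 → I) (q : Z → X.Realization) : Prop :=
  ∀ i : Fin c.cubes.length, ∀ z ∈ c.stage v i, q z = X.point (c.cubes.get i) (B i z)

variable {c : X.CubeChain x y}

theorem Follows.eq {Z : Type*} {v : Z → ℝ}
    {B : ∀ i : Fin c.cubes.length, Z → Fin (c.cubes.get i).1 → I} {q q' : Z → X.Realization}
    (h : c.Follows v B q) (h' : c.Follows v B q') {z : Z} (hz : 0 ≤ v z)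
    (hz' : v z ≤ c.position c.cubes.length) : q z = q' z := by
  obtain ⟨i, hi⟩ := c.exists_mem_stage hz hz'
  rw [h i z hi, h' i z hi]

namespace IsTrack

variable {Z : Type*} [TopologicalSpace Z] {v : Z → ℝ}
  {B B' : ∀ i : Fin c.cubes.length, Z → Fin (c.cubes.get i).1 → I}

theorem comp (hB : c.IsTrack v B) {W : Type*} [TopologicalSpace W] {g : W → Z}
    (hg : Continuous g) : c.IsTrack (v ∘ g) fun i => B i ∘ g where
  continuous i := (hB.continuous i).comp hg
  eq_zero i w := hB.eq_zero i (g w)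
  eq_one i w := hB.eq_one i (g w)

theorem convexComb (hB : c.IsTrack v B) (hB' : c.IsTrack v B') {s : Z → I} (hs : Continuous s) :
    c.IsTrack v fun i z k => Set.Icc.convexComb (B i z k) (B' i z k) (s z) where
  continuous i := by
    have := hB.continuous i
    have := hB'.continuous i
    fun_prop
  eq_zero i z hz := by simp only [hB.eq_zero i z hz, hB'.eq_zero i z hz, Set.Icc.convexComb_eq]
  eq_one i z hz := by simp only [hB.eq_one i z hz, hB'.eq_one i z hz, Set.Icc.convexComb_eq]

theorem point_eq_of_lt (hB : c.IsTrack v B) {i j : Fin c.cubes.length} (hij : i < j) {z : Z}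
    (hi : z ∈ c.stage v i) (hj : z ∈ c.stage v j) :
    X.point (c.cubes.get i) (B i z) = X.point (c.cubes.get j) (B j z) := by
  have hle : c.position (i + 1) ≤ c.position j := partialDim_mono _ hij
  have hsucc : (j : ℕ) = i + 1 := by
    refine le_antisymm (not_lt.1 fun hlt => ?_) hij
    exact (partialDim_lt _ c.dim_get_pos hlt (hlt.trans j.2)).not_ge (hj.1.trans hi.2)
  rw [hB.eq_one i z (le_antisymm hi.2 (hle.trans hj.1)),
    hB.eq_zero j z (le_antisymm (hi.2.trans hle) hj.1), point_one, point_zero, c.target_get hsucc]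

theorem point_eq (hB : c.IsTrack v B) {i j : Fin c.cubes.length} {z : Z}
    (hi : z ∈ c.stage v i) (hj : z ∈ c.stage v j) :
    X.point (c.cubes.get i) (B i z) = X.point (c.cubes.get j) (B j z) := by
  rcases lt_trichotomy i j with hij | rfl | hji
  · exact hB.point_eq_of_lt hij hi hj
  · rfl
  · exact (hB.point_eq_of_lt hji hj hi).symm

theorem exists_follows (hB : c.IsTrack v B) (hv : Continuous v) (hnonneg : ∀ z, 0 ≤ v z)
    (hle : ∀ z, v z ≤ c.position c.cubes.length) :
    ∃ q : C(Z, X.Realization), c.Follows v B q := by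
  choose i hi using fun z => c.exists_mem_stage (hnonneg z) (hle z)
  have hfollows : c.Follows v B fun z => X.point (c.cubes.get (i z)) (B (i z) z) :=
    fun j z hz => hB.point_eq (hi z) hz
  refine ⟨⟨_, (locallyFinite_of_finite fun j : Fin c.cubes.length => c.stage v j).continuous
    (Set.eq_univ_of_forall fun z => Set.mem_iUnion.2 ⟨i z, hi z⟩) (fun j => ?_) fun j => ?_⟩,
    hfollows⟩
  · exact (isClosed_le continuous_const hv).inter (isClosed_le hv continuous_const)
  · exact ((continuous_point _).comp (hB.continuous j)).continuousOn.congr (hfollows j)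

end IsTrack

theorem exists_times (c : X.CubeChain x y) {ℓ : I → ℝ}
    (hℓ : IsSchedule (c.position c.cubes.length) ℓ) :
    ∃ τ : Fin (c.cubes.length + 1) → I, Monotone τ ∧ τ 0 = 0 ∧ τ (Fin.last _) = 1 ∧
      ∀ k, ℓ (τ k) = c.position k := by
  have htime (k : Fin (c.cubes.length + 1)) :
      ∃ t, ℓ t = c.position k ∧ (k = 0 → t = 0) ∧ (k = Fin.last _ → t = 1) := by
    have hne : (0 : Fin (c.cubes.length + 1)) ≠ Fin.last _ := (Fin.mk_lt_mk.2 c.length_pos).ne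
    by_cases hk : k = 0
    · subst hk
      exact ⟨0, by rw [hℓ.zero, Fin.val_zero, position, partialDim_zero], fun _ => rfl,
        fun h => absurd h hne⟩
    by_cases hk' : k = Fin.last _
    · subst hk'
      exact ⟨1, hℓ.one, fun h => absurd h hne.symm, fun _ => rfl⟩
    have hmem : c.position k ∈ Set.Icc (ℓ 0) (ℓ 1) := by
      rw [hℓ.zero, hℓ.one]
      exact ⟨partialDim_nonneg _ _, partialDim_mono _ (Fin.is_le k)⟩
    obtain ⟨t, -, ht⟩ :=
      intermediate_value_Icc (zero_le_one (α := I)) hℓ.continuous.continuousOn hmem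
    exact ⟨t, ht, fun h => absurd h hk, fun h => absurd h hk'⟩
  choose τ hpos hzero hlast using htime
  refine ⟨τ, StrictMono.monotone fun k k' h => hℓ.monotone.reflect_lt ?_, hzero _ rfl,
    hlast _ rfl, hpos⟩
  rw [hpos, hpos]
  exact c.strictMono_position h

section

variable {q : C(I, X.Realization)} {ℓ : I → ℝ}
  {B : ∀ i : Fin c.cubes.length, I → Fin (c.cubes.get i).1 → I}

theorem IsTrack.exists_presentation (hB : c.IsTrack ℓ B)
    (hℓ : IsSchedule (c.position c.cubes.length) ℓ)
    (hmono : ∀ i, MonotoneOn (B i) (c.stage ℓ i)) (hq : c.Follows ℓ B q) :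
    ∃ P : X.Presentation q, List.ofFn P.cube = c.cubes ∧ P.IsFull ∧
      ((∀ i, StrictlyIncreasingOn (B i) (c.stage ℓ i)) →
        ∀ i, StrictlyIncreasingOn (P.coord i) (Set.Icc (P.time i.castSucc) (P.time i.succ))) := by
  obtain ⟨τ, hτ, hτ0, hτ1, hℓτ⟩ := c.exists_times hℓ
  have hstage (i : Fin c.cubes.length) : Set.Icc (τ i.castSucc) (τ i.succ) ⊆ c.stage ℓ i :=
    fun t ht => ⟨(hℓτ _).symm.le.trans (hℓ.monotone ht.1), (hℓ.monotone ht.2).trans (hℓτ _).le⟩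
  let P : X.Presentation q :=
    { len := c.cubes.length
      time := τ
      time_mono := hτ
      time_zero := hτ0
      time_last := hτ1
      cube := c.cubes.get
      coord := B
      continuousOn := fun i => (hB.continuous i).continuousOn
      monotoneOn := fun i => (hmono i).mono (hstage i)
      eq_point := fun i t ht => hq i t (hstage i ht) }
  exact ⟨P, List.ofFn_get _, fun i => ⟨hB.eq_zero i _ (hℓτ _), hB.eq_one i _ (hℓτ _)⟩,
    fun hstrict i => ⟨(hstrict i).1.mono (hstage i), fun k s hs s' hs' =>
      (hstrict i).2 k s (hstage i hs) s' (hstage i hs')⟩⟩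

theorem IsTrack.mem_tameSub (hB : c.IsTrack ℓ B) (hℓ : IsSchedule (c.position c.cubes.length) ℓ)
    (hmono : ∀ i, MonotoneOn (B i) (c.stage ℓ i)) (hq : c.Follows ℓ B q) : q ∈ c.tameSub := by
  obtain ⟨P, hcubes, hP, -⟩ := hB.exists_presentation hℓ hmono hq
  exact hP.mem_tameSub hcubes

theorem IsTrack.mem_strictTameSub (hB : c.IsTrack ℓ B)
    (hℓ : IsSchedule (c.position c.cubes.length) ℓ)
    (hstrict : ∀ i, StrictlyIncreasingOn (B i) (c.stage ℓ i)) (hq : c.Follows ℓ B q) :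
    q ∈ c.strictTameSub := by
  obtain ⟨P, hcubes, hP, hPstrict⟩ := hB.exists_presentation hℓ (fun i => (hstrict i).1) hq
  have htame : q ∈ c.tameSub := hP.mem_tameSub hcubes
  exact ⟨htame, htame.1.1, P, hPstrict hstrict⟩

end

section

variable {p : C(I, X.Realization)} {ℓ : I → ℝ}

theorem mem_range_of_isLength (h : IsLength p c.cubes.get ℓ) {i : Fin c.cubes.length} {t : I}
    (ht : t ∈ c.stage ℓ i) : p t ∈ Set.range (X.point (c.cubes.get i)) := by
  obtain ⟨z, hz, -⟩ := h.follows i t ht.1 ht.2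
  exact ⟨z, hz.symm⟩

theorem apply_eq_source_of_isLength (h : IsLength p c.cubes.get ℓ) {i : Fin c.cubes.length} {t : I}
    (ht : ℓ t = c.position i) : p t = X.vertex (X.source (c.cubes.get i)) := by
  obtain ⟨z, hz, hsum⟩ := h.follows i t ht.ge (ht.le.trans (partialDim_mono _ (Nat.le_succ _)))
  have hz0 : z = 0 := eq_zero_of_sum_eq_zero (by rw [hsum, ht, sub_self])
  rw [hz, hz0, point_zero]

theorem apply_eq_target_of_isLength (h : IsLength p c.cubes.get ℓ) {i : Fin c.cubes.length} {t : I}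
    (ht : ℓ t = c.position (i + 1)) : p t = X.vertex (X.target (c.cubes.get i)) := by
  obtain ⟨z, hz, hsum⟩ := h.follows i t ((partialDim_mono _ (Nat.le_succ _)).trans ht.ge) ht.le
  have hz1 : z = 1 :=
    eq_one_of_sum_eq (by rw [hsum, ht, position, partialDim_succ, add_sub_cancel_left])
  rw [hz, hz1, point_one]

theorem coords_eq_zero_of_isLength (hX : X.IsNonSelfLinked) (h : IsLength p c.cubes.get ℓ)
    {i : Fin c.cubes.length} {t : I} (ht : ℓ t = c.position i) :
    coords (c.cubes.get i) (p t) = 0 := by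
  rw [apply_eq_source_of_isLength h ht, ← point_zero, hX.coords_point]

theorem coords_eq_one_of_isLength (hX : X.IsNonSelfLinked) (h : IsLength p c.cubes.get ℓ)
    {i : Fin c.cubes.length} {t : I} (ht : ℓ t = c.position (i + 1)) :
    coords (c.cubes.get i) (p t) = 1 := by
  rw [apply_eq_target_of_isLength h ht, ← point_one, hX.coords_point]

theorem isTrack_coords (hX : X.IsNonSelfLinked) {Z : Type*} [TopologicalSpace Z]
    {q : Z → X.Realization} (hq : Continuous q) {v : Z → ℝ}
    (h : ∀ z, ∃ p ℓ t, IsLength p c.cubes.get ℓ ∧ q z = p t ∧ v z = ℓ t) :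
    c.IsTrack v fun i z => coords (c.cubes.get i) (q z) where
  continuous i := (continuous_coords _).comp hq
  eq_zero i z hz := by
    obtain ⟨p, ℓ, t, hℓ, hqt, hvt⟩ := h z
    rw [hqt, coords_eq_zero_of_isLength hX hℓ (hvt.symm.trans hz)]
  eq_one i z hz := by
    obtain ⟨p, ℓ, t, hℓ, hqt, hvt⟩ := h z
    rw [hqt, coords_eq_one_of_isLength hX hℓ (hvt.symm.trans hz)]

theorem follows_coords (hX : X.IsNonSelfLinked) (h : IsLength p c.cubes.get ℓ) :
    c.Follows ℓ (fun i t => coords (c.cubes.get i) (p t)) p := fun _ _ ht =>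
  (hX.point_coords (mem_range_of_isLength h ht)).symm

theorem monotoneOn_coords (hX : X.IsNonSelfLinked) (P : X.Presentation p)
    (h : IsLength p c.cubes.get ℓ) (i : Fin c.cubes.length) :
    MonotoneOn (fun t => coords (c.cubes.get i) (p t)) (c.stage ℓ i) := fun _ hs _ ht hst =>
  P.coords_le hX hst fun _ hr => mem_range_of_isLength h
    ⟨hs.1.trans (h.monotone hr.1), (h.monotone hr.2).trans ht.2⟩

theorem mem_tameSub_of_isLength (hX : X.IsNonSelfLinked) (P : X.Presentation p)
    (h : IsLength p c.cubes.get ℓ) : p ∈ c.tameSub :=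
  (isTrack_coords hX p.continuous fun t => ⟨p, ℓ, t, h, rfl, rfl⟩).mem_tameSub h.toIsSchedule
    (monotoneOn_coords hX P h) (follows_coords hX h)

end

end CubeChain

/-! ### Contracting spaces of tame paths -/

theorem convexComb_mono {a a' b b' : I} (ha : a ≤ a') (hb : b ≤ b') (s : I) :
    Set.Icc.convexComb a b s ≤ Set.Icc.convexComb a' b' s := by
  rw [← Subtype.coe_le_coe, Set.Icc.coe_convexComb, Set.Icc.coe_convexComb]
  exact add_le_add (mul_le_mul_of_nonneg_left ha (sub_nonneg.2 s.2.2))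
    (mul_le_mul_of_nonneg_left hb s.2.1)

theorem eq_of_convexComb_eq {s a a' b b' : I} (hs : 0 < s) (ha : a ≤ a') (hb : b ≤ b')
    (h : Set.Icc.convexComb a b s = Set.Icc.convexComb a' b' s) : b = b' := by
  have hcoe : (1 - (s : ℝ)) * a + s * b = (1 - s) * a' + s * b' := congrArg Subtype.val h
  have hmul : (1 - (s : ℝ)) * a ≤ (1 - s) * a' := mul_le_mul_of_nonneg_left ha (sub_nonneg.2 s.2.2)
  exact le_antisymm hb (le_of_mul_le_mul_left (show (s : ℝ) * b' ≤ s * b by linarith) hs)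

/-- A function increasing in both variables which fixes `l = 0` and `l = 1`, and is strictly
increasing in `t` for all other `l`. -/
def ramp (l t : I) : I := Set.Icc.convexComb (l * l) l t

theorem continuous_ramp : Continuous fun z : I × I => ramp z.1 z.2 := by
  unfold ramp
  fun_prop

theorem ramp_eq_zero_iff {l t : I} : ramp l t = 0 ↔ l = 0 := by
  refine ⟨fun h => ?_, fun h => by rw [ramp, h, mul_zero, Set.Icc.convexComb_eq]⟩
  have hle : l * l ≤ 0 := (Set.Icc.le_convexComb unitInterval.mul_le_left t).trans h.le
  exact mul_self_eq_zero.1 (le_antisymm hle unitInterval.nonneg')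

theorem ramp_eq_one_iff {l t : I} : ramp l t = 1 ↔ l = 1 := by
  refine ⟨fun h => ?_, fun h => by rw [ramp, h, mul_one, Set.Icc.convexComb_eq]⟩
  exact le_antisymm unitInterval.le_one'
    (h.symm.le.trans (Set.Icc.convexComb_le unitInterval.mul_le_left t))

theorem ramp_mono_left {l l' : I} (h : l ≤ l') (t : I) : ramp l t ≤ ramp l' t :=
  convexComb_mono (mul_le_mul' h h) h t

theorem coe_ramp (l t : I) : (ramp l t : ℝ) = l * l + t * (l * (1 - l)) := by
  rw [ramp, Set.Icc.coe_convexComb, Set.Icc.coe_mul]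
  ring

theorem ramp_mono_right (l : I) : Monotone (ramp l) := fun t t' h => by
  have hle : (t : ℝ) * (l * (1 - l)) ≤ t' * (l * (1 - l)) :=
    mul_le_mul_of_nonneg_right h (mul_nonneg l.2.1 (sub_nonneg.2 l.2.2))
  rw [← Subtype.coe_le_coe, coe_ramp, coe_ramp]
  gcongr

theorem ramp_strictMono {l : I} (h0 : l ≠ 0) (h1 : l ≠ 1) : StrictMono (ramp l) := fun t t' h => by
  have hpos : (0 : ℝ) < l * (1 - l) :=
    mul_pos (unitInterval.pos_iff_ne_zero.2 h0) (sub_pos.2 (unitInterval.lt_one_iff_ne_one.2 h1))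
  rw [← Subtype.coe_lt_coe, coe_ramp, coe_ramp]
  gcongr

theorem eq_zero_or_one_of_ramp_eq {l l' t t' : I} (hl : l ≤ l') (ht : t < t')
    (h : ramp l t = ramp l' t') : l = 0 ∨ l = 1 := by
  by_contra! hl'
  exact ((ramp_strictMono hl'.1 hl'.2 ht).trans_le (ramp_mono_left hl t')).ne h

theorem strictlyIncreasingOn_of_lt {n : ℕ} {β : I → Fin n → I} {J : Set I} (hβ : MonotoneOn β J)
    (h : ∀ k, ∀ t ∈ J, ∀ t' ∈ J, t < t' → β t k = β t' k → β t k = 0 ∨ β t k = 1) :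
    StrictlyIncreasingOn β J := by
  refine ⟨hβ, fun k t ht t' ht' heq => ?_⟩
  rcases lt_trichotomy t t' with hlt | heq' | hlt
  · exact .inr (h k t ht t' ht' hlt heq)
  · exact .inl heq'
  · exact .inr (heq ▸ h k t' ht' t ht hlt heq.symm)

theorem strictlyIncreasingOn_ramp {n : ℕ} {l : I → I} (hl : Monotone l) (J : Set I) :
    StrictlyIncreasingOn (fun t (_ : Fin n) => ramp (l t) t) J :=
  strictlyIncreasingOn_of_lt
    (fun t _ _ _ h _ => (ramp_mono_left (hl h) t).trans (ramp_mono_right _ h))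
    fun _ _ _ _ _ hlt heq => (eq_zero_or_one_of_ramp_eq (hl hlt.le) hlt heq).imp
      ramp_eq_zero_iff.2 ramp_eq_one_iff.2

theorem StrictlyIncreasingOn.convexComb {n : ℕ} {a b : I → Fin n → I} {J : Set I} {s : I}
    (hb : StrictlyIncreasingOn b J) (hs : 0 < s) (ha : MonotoneOn a J)
    (hzero : ∀ t ∈ J, ∀ k, b t k = 0 → a t k = 0) (hone : ∀ t ∈ J, ∀ k, b t k = 1 → a t k = 1) :
    StrictlyIncreasingOn (fun t k => Set.Icc.convexComb (a t k) (b t k) s) J := by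
  refine strictlyIncreasingOn_of_lt
    (fun t ht t' ht' h k => convexComb_mono (ha ht ht' h k) (hb.1 ht ht' h k) s)
    fun k t ht t' ht' hlt heq => ?_
  have hbeq : b t k = b t' k :=
    eq_of_convexComb_eq hs (ha ht ht' hlt.le k) (hb.1 ht ht' hlt.le k) heq
  refine ((hb.2 k t ht t' ht' hbeq).resolve_left hlt.ne).imp (fun h => ?_) fun h => ?_
  · simp only [h, hzero t ht k h, Set.Icc.convexComb_eq]
  · simp only [h, hone t ht k h, Set.Icc.convexComb_eq]

theorem exists_homotopic_of_family {Y : Type*} [TopologicalSpace Y] {K : Set C(I, Y)}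
    (f : C(K, K)) (F : C(I × K × I, Y))
    (hK : ∀ s p (q : C(I, Y)), (∀ t, q t = F (s, p, t)) → q ∈ K)
    (hf : ∀ p t, (f p).1 t = F (0, p, t)) :
    ∃ g : C(K, K), f.Homotopic g ∧ ∀ p t, (g p).1 t = F (1, p, t) := by
  let Φ : C(I × K, C(I, Y)) := (F.comp (ContinuousMap.mk fun z : (I × K) × I =>
    (z.1.1, z.1.2, z.2))).curry
  let Ψ : C(I × K, K) := ⟨fun z => ⟨Φ z, hK z.1 z.2 _ fun _ => rfl⟩, Φ.continuous.subtype_mk _⟩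
  refine ⟨⟨fun p => Ψ (1, p), by fun_prop⟩, ⟨⟨Ψ, fun p => ?_, fun p => rfl⟩⟩, fun p t => rfl⟩
  exact Subtype.ext (ContinuousMap.ext fun t => (hf p t).symm)

theorem continuous_length {Y : Type*} [TopologicalSpace Y] {r : Y → C(I, X.Realization)}
    (hr : Continuous r) {n : ℕ} {f : Fin n → X.Cube} {ℓ : Y → I → ℝ}
    (hℓ : ∀ y, IsLength (r y) f (ℓ y)) : Continuous fun z : Y × I => ℓ z.1 z.2 := by
  have heval : Continuous fun z : I × Y => r z.2 z.1 :=
    Continuous.eval (hr.comp continuous_snd) continuous_fst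
  have hcover := AddCircle.isCoveringMap_coe (1 : ℝ)
  have hlift : Continuous fun z : I × Y => ℓ z.2 z.1 := by
    refine hcover.isLocalHomeomorph.continuous_lift hcover.isSeparatedMap
      ⟨fun z : I × Y => phase (r z.2 z.1), phase.continuous.comp heval⟩
      (funext fun z => (hℓ z.2).lifts z.1) ?_ fun y => (hℓ y).continuous
    simp only [(hℓ _).zero]
    exact continuous_const
  exact hlift.comp continuous_swap

namespace CubeChain

variable {c : X.CubeChain x y}

/-- The fraction of the `i`-th cube that is covered at position `v` along the cube chain. -/
noncomputable def progress (c : X.CubeChain x y) (i : Fin c.cubes.length) (v : ℝ) : I :=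
  Set.projIcc 0 1 zero_le_one ((v - c.position i) / (c.cubes.get i).1)

theorem continuous_progress (i : Fin c.cubes.length) : Continuous (c.progress i) :=
  continuous_projIcc.comp (by fun_prop)

theorem monotone_progress (i : Fin c.cubes.length) : Monotone (c.progress i) :=
  fun _ _ h => Set.monotone_projIcc _ (by gcongr)

theorem progress_eq_zero_iff {i : Fin c.cubes.length} {v : ℝ} :
    c.progress i v = 0 ↔ v ≤ c.position i := by
  have hdim : (0 : ℝ) < (c.cubes.get i).1 := by exact_mod_cast c.dim_get_pos i
  exact (Set.projIcc_eq_left zero_lt_one).trans (by rw [div_le_iff₀ hdim, zero_mul, sub_nonpos])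

theorem progress_eq_one_iff {i : Fin c.cubes.length} {v : ℝ} :
    c.progress i v = 1 ↔ c.position (i + 1) ≤ v := by
  have hdim : (0 : ℝ) < (c.cubes.get i).1 := by exact_mod_cast c.dim_get_pos i
  exact (Set.projIcc_eq_right zero_lt_one).trans
    (by rw [one_le_div hdim, le_sub_iff_add_le', ← partialDim_succ])

theorem isTrack_diagonal {Z : Type*} [TopologicalSpace Z] {v : Z → ℝ} (hv : Continuous v)
    {τ : Z → I} (hτ : Continuous τ) :
    c.IsTrack v fun i z _ => ramp (c.progress i (v z)) (τ z) where
  continuous i := continuous_pi fun _ =>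
    continuous_ramp.comp (((continuous_progress i).comp hv).prodMk hτ)
  eq_zero _ _ hz := funext fun _ => ramp_eq_zero_iff.2 (progress_eq_zero_iff.2 hz.le)
  eq_one _ _ hz := funext fun _ => ramp_eq_one_iff.2 (progress_eq_one_iff.2 hz.ge)

theorem strictlyIncreasingOn_diagonal {ℓ : I → ℝ} (hℓ : Monotone ℓ) (i : Fin c.cubes.length)
    (J : Set I) : StrictlyIncreasingOn
      (fun t (_ : Fin (c.cubes.get i).1) => ramp (c.progress i (ℓ t)) t) J :=
  strictlyIncreasingOn_ramp ((monotone_progress i).comp hℓ) J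

theorem strictlyIncreasingOn_convexComb_coords (hX : X.IsNonSelfLinked) {p : C(I, X.Realization)}
    (P : X.Presentation p) {ℓ : I → ℝ} (hℓ : IsLength p c.cubes.get ℓ) {s : I} (hs : 0 < s)
    (i : Fin c.cubes.length) : StrictlyIncreasingOn (fun t k =>
      Set.Icc.convexComb (coords (c.cubes.get i) (p t) k) (ramp (c.progress i (ℓ t)) t) s)
      (c.stage ℓ i) := by
  refine (strictlyIncreasingOn_diagonal hℓ.monotone i _).convexComb hs
    (monotoneOn_coords hX P hℓ i) (fun t ht k h => ?_) fun t ht k h => ?_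
  · have heq : ℓ t = c.position i :=
      le_antisymm (progress_eq_zero_iff.1 (ramp_eq_zero_iff.1 h)) ht.1
    exact congrFun (coords_eq_zero_of_isLength hX hℓ heq) k
  · have heq : ℓ t = c.position (i + 1) :=
      le_antisymm ht.2 (progress_eq_one_iff.1 (ramp_eq_one_iff.1 h))
    exact congrFun (coords_eq_one_of_isLength hX hℓ heq) k

variable {K : Set C(I, X.Realization)}

theorem IsTrack.exists_homotopic (hK : c.strictTameSub ⊆ K) {v : I × K × I → ℝ}
    {B : ∀ i : Fin c.cubes.length, I × K × I → Fin (c.cubes.get i).1 → I} (hB : c.IsTrack v B)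
    (hv : Continuous v) (hschedule : ∀ s p, IsSchedule (c.position c.cubes.length)
      fun t => v (s, p, t))
    (hstrict : ∀ s p, 0 < s → ∀ i, StrictlyIncreasingOn (fun t => B i (s, p, t))
      (c.stage (fun t => v (s, p, t)) i))
    (f : C(K, K)) (hf : ∀ p, c.Follows (fun t => v (0, p, t)) (fun i t => B i (0, p, t)) (f p).1) :
    ∃ g : C(K, K), f.Homotopic g ∧
      ∀ p, c.Follows (fun t => v (1, p, t)) (fun i t => B i (1, p, t)) (g p).1 := by
  obtain ⟨F, hF⟩ := hB.exists_follows hv (fun z => (hschedule z.1 z.2.1).nonneg z.2.2)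
    fun z => (hschedule z.1 z.2.1).le z.2.2
  have hfF (p : K) (t : I) : (f p).1 t = F (0, p, t) :=
    (hf p).eq (fun i t ht => hF i (0, p, t) ht) ((hschedule 0 p).nonneg t) ((hschedule 0 p).le t)
  have hFK (s : I) (p : K) (q : C(I, X.Realization)) (hq : ∀ t, q t = F (s, p, t)) : q ∈ K := by
    rcases eq_or_lt_of_le (unitInterval.nonneg' (t := s)) with rfl | hs
    · rw [show q = (f p).1 from ContinuousMap.ext fun t => (hq t).trans (hfF p t).symm]
      exact (f p).2
    · have hslice : Continuous fun t : I => (s, p, t) := by fun_prop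
      exact hK ((hB.comp hslice).mem_strictTameSub (hschedule s p) (hstrict s p hs)
        fun i t ht => (hq t).trans (hF i (s, p, t) ht))
  obtain ⟨g, hfg, hg⟩ := exists_homotopic_of_family f F hFK hfF
  exact ⟨g, hfg, fun p i t ht => (hg p t).trans (hF i (1, p, t) ht)⟩

theorem exists_homotopic_diagonal (hX : X.IsNonSelfLinked) (hK : c.strictTameSub ⊆ K)
    (r : C(K, K)) (hr : ∀ p, (r p).1 ∈ c.tameSub) {ℓ : K → I → ℝ}
    (hℓ : ∀ p, IsLength (r p).1 c.cubes.get (ℓ p)) :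
    ∃ g : C(K, K), r.Homotopic g ∧
      ∀ p, c.Follows (ℓ p) (fun i t _ => ramp (c.progress i (ℓ p t)) t) (g p).1 := by
  have hr' : Continuous fun p => (r p).1 := continuous_subtype_val.comp r.continuous
  have hv : Continuous fun z : I × K × I => ℓ z.2.1 z.2.2 :=
    (continuous_length hr' hℓ).comp continuous_snd
  have heval : Continuous fun z : I × K × I => (r z.2.1).1 z.2.2 :=
    Continuous.eval (hr'.comp (by fun_prop)) (by fun_prop)
  have hcoords := isTrack_coords (c := c) hX heval (v := fun z => ℓ z.2.1 z.2.2)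
    fun z => ⟨(r z.2.1).1, ℓ z.2.1, z.2.2, hℓ z.2.1, rfl, rfl⟩
  have hmixed := hcoords.convexComb (isTrack_diagonal hv (τ := fun z => z.2.2) (by fun_prop))
    continuous_fst
  obtain ⟨g, hrg, hg⟩ := hmixed.exists_homotopic hK hv (fun _ p => (hℓ p).toIsSchedule)
    (fun _ p hs => strictlyIncreasingOn_convexComb_coords hX (hr p).1.1.2.2.some (hℓ p) hs) r
    fun p => by simpa only [Set.Icc.convexComb_zero] using follows_coords hX (hℓ p)
  exact ⟨g, hrg, by simpa only [Set.Icc.convexComb_one] using hg⟩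

theorem exists_follows_diagonal (c : X.CubeChain x y) : ∃ q ∈ c.strictTameSub,
    c.Follows (fun t : I => c.position c.cubes.length * t)
      (fun i t _ => ramp (c.progress i (c.position c.cubes.length * t)) t) q := by
  have hlinear := IsSchedule.mul_coe (partialDim_nonneg c.cubes.get c.cubes.length)
  have hdiagonal := isTrack_diagonal (c := c) hlinear.continuous continuous_id
  obtain ⟨q, hq⟩ := hdiagonal.exists_follows hlinear.continuous hlinear.nonneg hlinear.le
  exact ⟨q, hdiagonal.mem_strictTameSub hlinear
    (fun i => strictlyIncreasingOn_diagonal hlinear.monotone i _) hq, hq⟩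

theorem nullhomotopic_of_follows_diagonal (hK : c.strictTameSub ⊆ K) (g : C(K, K))
    {ℓ : K → I → ℝ} (hℓ : Continuous fun z : K × I => ℓ z.1 z.2)
    (hschedule : ∀ p, IsSchedule (c.position c.cubes.length) (ℓ p))
    (hg : ∀ p, c.Follows (ℓ p) (fun i t _ => ramp (c.progress i (ℓ p t)) t) (g p).1) :
    g.Nullhomotopic := by
  have hlinear := IsSchedule.mul_coe (partialDim_nonneg c.cubes.get c.cubes.length)
  obtain ⟨q, hqc, hq⟩ := c.exists_follows_diagonal
  let v (z : I × K × I) : ℝ :=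
    (1 - z.1) * ℓ z.2.1 z.2.2 + z.1 * (c.position c.cubes.length * z.2.2)
  have hv : Continuous v := by
    have := hℓ.comp (continuous_snd (X := I))
    exact ((continuous_const.sub (by fun_prop)).mul this).add (by fun_prop)
  have hvschedule (s : I) (p : K) := (hschedule p).convex hlinear s
  obtain ⟨g', hgg', hg'⟩ := (isTrack_diagonal hv (τ := fun z => z.2.2)
    (by fun_prop)).exists_homotopic hK hv hvschedule
    (fun s p _ i => strictlyIncreasingOn_diagonal (hvschedule s p).monotone i _) g
    fun p => by simpa [v] using hg p
  refine ⟨⟨q, hK hqc⟩, hgg'.trans ?_⟩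
  rw [show g' = ContinuousMap.const K ⟨q, hK hqc⟩ from ?_]
  ext p t
  have hfollows := hg' p
  simp only [v, Set.Icc.coe_one, sub_self, zero_mul, zero_add, one_mul] at hfollows
  exact hfollows.eq hq (hlinear.nonneg t) (hlinear.le t)

theorem nullhomotopic_of_tame (hX : X.IsNonSelfLinked) (hK : c.strictTameSub ⊆ K)
    (r : C(K, K)) (hr : ∀ p, (r p).1 ∈ c.tameSub) : r.Nullhomotopic := by
  choose ℓ hℓ using fun p => c.exists_isLength (hr p)
  obtain ⟨g, hrg, hg⟩ := exists_homotopic_diagonal hX hK r hr hℓ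
  obtain ⟨q, hgq⟩ := nullhomotopic_of_follows_diagonal hK g
    (continuous_length (continuous_subtype_val.comp r.continuous) hℓ)
    (fun p => (hℓ p).toIsSchedule) hg
  exact ⟨q, hrg.trans hgq⟩

theorem contractibleSpace_of_tame (hX : X.IsNonSelfLinked) (hK : c.strictTameSub ⊆ K)
    (hK' : K ⊆ c.tameSub) : ContractibleSpace K :=
  (contractible_iff_id_nullhomotopic K).2
    (nullhomotopic_of_tame hX hK (ContinuousMap.id K) fun p => hK' p.2)

end CubeChain

/-! ### Pushing paths in collars into cube chains -/

theorem StrictlyIncreasingOn.stretch {n : ℕ} {β : I → Fin n → I} {J : Set I}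
    (h : StrictlyIncreasingOn β J) (κ : ℝ) :
    StrictlyIncreasingOn (fun t k => stretch κ (β t k)) J := by
  refine ⟨fun s hs t ht hst k => stretch_mono κ (h.1 hs ht hst k), fun k s hs s' hs' heq => ?_⟩
  rcases eq_or_eq_endpoint_of_stretch_eq heq with hβ | hstretch
  · refine (h.2 k s hs s' hs' hβ).imp_right (.imp (fun hzero => ?_) fun hone => ?_)
    · simp only [hzero]; exact stretch_endpoint κ false
    · simp only [hone]; exact stretch_endpoint κ true
  · exact .inr hstretch

/-- The image of a presentation under a dilation. -/
noncomputable def Presentation.dilate {p q : C(I, X.Realization)} (P : X.Presentation p) (κ : ℝ)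
    (hq : ∀ t, q t = dilate κ (p t)) : X.Presentation q where
  len := P.len
  time := P.time
  time_mono := P.time_mono
  time_zero := P.time_zero
  time_last := P.time_last
  cube := P.cube
  coord i t k := stretch κ (P.coord i t k)
  continuousOn i := by
    have hstretch : Continuous fun (z : Fin (P.cube i).1 → I) k => stretch κ (z k) :=
      continuous_pi fun k => continuous_stretch.comp
        (f := fun z : Fin (P.cube i).1 → I => (z k, κ)) (by fun_prop)
    exact hstretch.comp_continuousOn (P.continuousOn i)
  monotoneOn i s hs t ht hst k := stretch_mono κ (P.monotoneOn i hs ht hst k)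
  eq_point i s hs := by rw [hq, P.eq_point i s hs, dilate_point]

section dilate

variable {p q : C(I, X.Realization)} {κ : ℝ}

theorem dilate_mem_dPaths (hp : p ∈ X.dPaths x y) (hq : ∀ t, q t = dilate κ (p t)) :
    q ∈ X.dPaths x y := by
  obtain ⟨hsource, htarget, ⟨P⟩⟩ := hp
  exact ⟨by rw [hq, hsource, dilate_vertex], by rw [hq, htarget, dilate_vertex], ⟨P.dilate κ hq⟩⟩

theorem dilate_mem_strictPaths (hp : p ∈ X.strictPaths x y) (hq : ∀ t, q t = dilate κ (p t)) :
    q ∈ X.strictPaths x y := by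
  obtain ⟨hd, P, hP⟩ := hp
  exact ⟨dilate_mem_dPaths hd hq, P.dilate κ hq, fun i => (hP i).stretch κ⟩

theorem CubeChain.dilate_mem_collarSub {c : X.CubeChain x y} (hp : p ∈ c.collarSub)
    (hq : ∀ t, q t = dilate κ (p t)) : q ∈ c.collarSub := by
  obtain ⟨hd, t, ht, ht0, ht1, hcollar⟩ := hp
  simp only [CubeChain.collarSub, Set.mem_ofPred_eq, hq]
  exact ⟨dilate_mem_dPaths hd hq, t, ht, ht0, ht1, fun i =>
    ⟨fun s hs => dilate_mem_collar κ ((hcollar i).1 s hs), dilate_mem_collar κ (hcollar i).2.1,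
      dilate_mem_collar κ (hcollar i).2.2⟩⟩

end dilate

namespace CubeChain

theorem tameSub_subset_collarSub (c : X.CubeChain x y) : c.tameSub ⊆ c.collarSub := by
  intro p hp
  obtain ⟨ℓ, hℓ⟩ := c.exists_isLength hp
  obtain ⟨τ, hτ, hτ0, hτ1, hℓτ⟩ := c.exists_times hℓ.toIsSchedule
  refine ⟨hp.1.1, τ, hτ, hτ0, hτ1, fun i => ⟨fun s hs => ?_, ?_, ?_⟩⟩
  · obtain ⟨z, hz⟩ := mem_range_of_isLength hℓ (i := i) (t := s)
      ⟨(hℓτ _).symm.le.trans (hℓ.monotone hs.1), (hℓ.monotone hs.2).trans (hℓτ _).le⟩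
    exact hz ▸ point_mem_collar _ z
  · exact apply_eq_source_of_isLength hℓ (hℓτ i.castSucc) ▸ vertex_mem_star _
  · exact apply_eq_target_of_isLength hℓ (hℓτ i.succ) ▸ vertex_mem_star _

theorem strictTameSub_subset_strictCollarSub (c : X.CubeChain x y) :
    c.strictTameSub ⊆ c.strictCollarSub :=
  Set.inter_subset_inter_left _ c.tameSub_subset_collarSub

/-- How deep the path `p`, subdivided at the times `t`, lies in the collars of the cubes of `c`.
The parameter `s` runs through `I` and is clamped to the `i`-th interval, so that the infimum is
over a compact set independent of `t`. -/
noncomputable def subdivisionDepth (c : X.CubeChain x y) (p : C(I, X.Realization))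
    (t : Fin (c.cubes.length + 1) → I) : I :=
  Finset.univ.inf fun i : Fin c.cubes.length =>
    sInf ((fun s => collarDepth (c.cubes.get i) (p (t i.castSucc ⊔ s ⊓ t i.succ))) '' Set.univ) ⊓
      (collarDepth (X.vertexCube (X.source (c.cubes.get i))) (p (t i.castSucc)) ⊓
        collarDepth (X.vertexCube (X.target (c.cubes.get i))) (p (t i.succ)))

theorem continuous_subdivisionDepth (c : X.CubeChain x y) : Continuous ↿(c.subdivisionDepth) := by
  change Continuous fun z : C(I, X.Realization) × (Fin (c.cubes.length + 1) → I) =>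
    c.subdivisionDepth z.1 z.2
  unfold subdivisionDepth
  refine Continuous.finset_inf_apply fun i _ => Continuous.inf ?_ (Continuous.inf ?_ ?_)
  · refine isCompact_univ.continuous_sInf
      (f := fun (z : C(I, X.Realization) × (Fin (c.cubes.length + 1) → I)) (s : I) =>
        collarDepth (c.cubes.get i) (z.1 (z.2 i.castSucc ⊔ s ⊓ z.2 i.succ))) ?_
    change Continuous fun w : (C(I, X.Realization) × (Fin (c.cubes.length + 1) → I)) × I =>
      collarDepth (c.cubes.get i) (w.1.1 (w.1.2 i.castSucc ⊔ w.2 ⊓ w.1.2 i.succ))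
    exact (ContinuousMap.continuous _).comp (Continuous.eval (by fun_prop) (by fun_prop))
  all_goals exact (ContinuousMap.continuous _).comp (Continuous.eval (by fun_prop) (by fun_prop))

section

variable {c : X.CubeChain x y} {p : C(I, X.Realization)} {t : Fin (c.cubes.length + 1) → I} {η : I}

theorem le_collarDepth_of_le_subdivisionDepth (h : η ≤ c.subdivisionDepth p t)
    (i : Fin c.cubes.length) : (∀ s ∈ Set.Icc (t i.castSucc) (t i.succ),
        η ≤ collarDepth (c.cubes.get i) (p s)) ∧
      η ≤ collarDepth (X.vertexCube (X.source (c.cubes.get i))) (p (t i.castSucc)) ∧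
      η ≤ collarDepth (X.vertexCube (X.target (c.cubes.get i))) (p (t i.succ)) := by
  obtain ⟨hcube, hsource, htarget⟩ : _ ∧ _ ∧ _ := by
    simpa only [le_inf_iff] using Finset.le_inf_iff.1 h i (Finset.mem_univ i)
  refine ⟨fun s hs => hcube.trans (csInf_le (OrderBot.bddBelow _) ⟨s, Set.mem_univ s, ?_⟩),
    hsource, htarget⟩
  simp only [inf_eq_left.2 hs.2, sup_eq_right.2 hs.1]

theorem subdivisionDepth_pos (ht : Monotone t) (hcollar : ∀ i : Fin c.cubes.length,
      (∀ s ∈ Set.Icc (t i.castSucc) (t i.succ), p s ∈ X.collar (c.cubes.get i)) ∧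
      p (t i.castSucc) ∈ X.star (X.source (c.cubes.get i)) ∧
      p (t i.succ) ∈ X.star (X.target (c.cubes.get i))) : 0 < c.subdivisionDepth p t := by
  refine (Finset.lt_inf_iff (show (0 : I) < 1 from zero_lt_one)).2 fun i _ => lt_inf_iff.2
    ⟨?_, lt_inf_iff.2 ⟨collarDepth_pos (hcollar i).2.1, collarDepth_pos (hcollar i).2.2⟩⟩
  have hle : t i.castSucc ≤ t i.succ := ht i.castSucc_lt_succ.le
  have hcont : Continuous fun s =>
      collarDepth (c.cubes.get i) (p (t i.castSucc ⊔ s ⊓ t i.succ)) :=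
    (ContinuousMap.continuous _).comp (p.continuous.comp (by fun_prop))
  obtain ⟨s, -, hs⟩ := isCompact_univ.exists_sInf_image_eq Set.univ_nonempty hcont.continuousOn
  rw [hs]
  exact collarDepth_pos ((hcollar i).1 _ ⟨le_sup_left, sup_le hle inf_le_right⟩)

end

/-- The subdivisions `0 = t_0 ≤ ⋯ ≤ t_n = 1` of the unit interval. -/
def subdivisions (n : ℕ) : Set (Fin (n + 1) → I) :=
  {t | Monotone t ∧ t 0 = 0 ∧ t (Fin.last n) = 1}

theorem isCompact_subdivisions (n : ℕ) : IsCompact (subdivisions n) :=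
  (isClosed_monotone.inter
    ((isClosed_eq (continuous_apply _) continuous_const).inter
      (isClosed_eq (continuous_apply _) continuous_const))).isCompact

/-- How deep the path `p` lies in the collars of the cubes of `c`, for the best subdivision. -/
noncomputable def pathDepth (c : X.CubeChain x y) (p : C(I, X.Realization)) : I :=
  sSup (c.subdivisionDepth p '' subdivisions c.cubes.length)

theorem continuous_pathDepth (c : X.CubeChain x y) : Continuous c.pathDepth :=
  (isCompact_subdivisions _).continuous_sSup c.continuous_subdivisionDepth

variable {c : X.CubeChain x y} {p : C(I, X.Realization)}

theorem pathDepth_pos (hp : p ∈ c.collarSub) : 0 < c.pathDepth p := by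
  obtain ⟨-, t, ht, ht0, ht1, hcollar⟩ := hp
  exact (subdivisionDepth_pos ht hcollar).trans_le
    (le_csSup (OrderTop.bddAbove _) ⟨t, ⟨ht, ht0, ht1⟩, rfl⟩)

theorem exists_subdivisionDepth_eq_pathDepth (hp : p ∈ c.collarSub) :
    ∃ t ∈ subdivisions c.cubes.length, c.subdivisionDepth p t = c.pathDepth p := by
  obtain ⟨-, t, ht, ht0, ht1, -⟩ := hp
  have hcont : Continuous (c.subdivisionDepth p) :=
    c.continuous_subdivisionDepth.comp (f := fun t => (p, t)) (by fun_prop)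
  obtain ⟨t', ht', heq⟩ := (isCompact_subdivisions _).exists_sSup_image_eq
    ⟨t, ht, ht0, ht1⟩ hcont.continuousOn
  exact ⟨t', ht', heq.symm⟩

theorem dilate_mem_tameSub (hX : X.IsNonSelfLinked) {q : C(I, X.Realization)}
    (hp : p ∈ c.collarSub) {η : I} (hη : 0 < η) (hle : η ≤ c.pathDepth p)
    (hq : ∀ t, q t = dilate (η : ℝ)⁻¹ (p t)) : q ∈ c.tameSub := by
  obtain ⟨t, ⟨ht, ht0, ht1⟩, hdepth⟩ := exists_subdivisionDepth_eq_pathDepth hp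
  have hdeep := le_collarDepth_of_le_subdivisionDepth (hle.trans hdepth.ge)
  obtain ⟨P⟩ := (dilate_mem_dPaths hp.1 hq).2.2
  have hrange (i : Fin c.cubes.length) (s) (hs : s ∈ Set.Icc (t i.castSucc) (t i.succ)) :
      q s ∈ Set.range (X.point (c.cubes.get i)) :=
    hq s ▸ dilate_mem_range_point hη ((hdeep i).1 s hs)
  have hsource (i : Fin c.cubes.length) :
      q (t i.castSucc) = X.vertex (X.source (c.cubes.get i)) :=
    eq_vertex_of_mem_range (hq _ ▸ dilate_mem_range_point hη (hdeep i).2.1)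
  have htarget (i : Fin c.cubes.length) : q (t i.succ) = X.vertex (X.target (c.cubes.get i)) :=
    eq_vertex_of_mem_range (hq _ ▸ dilate_mem_range_point hη (hdeep i).2.2)
  let Q : X.Presentation q :=
    { len := c.cubes.length
      time := t
      time_mono := ht
      time_zero := ht0
      time_last := ht1
      cube := c.cubes.get
      coord := fun i s => coords (c.cubes.get i) (q s)
      continuousOn := fun i => ((continuous_coords _).comp q.continuous).continuousOn
      monotoneOn := fun i s hs s' hs' hss => P.coords_le hX hss fun r hr =>
        hrange i r ⟨hs.1.trans hr.1, hr.2.trans hs'.2⟩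
      eq_point := fun i s hs => (hX.point_coords (hrange i s hs)).symm }
  have hQ : Q.IsFull := fun i =>
    ⟨by simp only [Q, hsource, ← point_zero, hX.coords_point],
      by simp only [Q, htarget, ← point_one, hX.coords_point]⟩
  exact hQ.mem_tameSub (List.ofFn_get _)

section Family

variable {ι : Type*} {c : ι → X.CubeChain x y} {K : Set C(I, X.Realization)}

section depth

variable [Fintype ι]

/-- How deep a path lies in the collars of a family of cube chains. -/
noncomputable def familyDepth (c : ι → X.CubeChain x y) (p : C(I, X.Realization)) : I :=
  Finset.univ.inf fun i => (c i).pathDepth p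

theorem continuous_familyDepth : Continuous (familyDepth c) :=
  Continuous.finset_inf_apply fun i _ => (c i).continuous_pathDepth

theorem familyDepth_pos (hp : ∀ i, p ∈ (c i).collarSub) : 0 < familyDepth c p :=
  (Finset.lt_inf_iff (show (0 : I) < 1 from zero_lt_one)).2 fun i _ => pathDepth_pos (hp i)

theorem dilate_mem_tameSub_of_family (hX : X.IsNonSelfLinked) (hp : ∀ i, p ∈ (c i).collarSub)
    {q : C(I, X.Realization)} (hq : ∀ t, q t = dilate (familyDepth c p : ℝ)⁻¹ (p t)) (i : ι) :
    q ∈ (c i).tameSub :=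
  dilate_mem_tameSub hX (hp i) (familyDepth_pos hp) (Finset.inf_le (Finset.mem_univ i)) hq

theorem exists_homotopic_dilate (hK : ∀ p ∈ K, ∀ i, p ∈ (c i).collarSub)
    (hdilate : ∀ p ∈ K, ∀ (κ : ℝ) (q : C(I, X.Realization)),
      (∀ t, q t = dilate κ (p t)) → q ∈ K) :
    ∃ g : C(K, K), (ContinuousMap.id K).Homotopic g ∧
      ∀ p t, (g p).1 t = dilate (familyDepth c p.1 : ℝ)⁻¹ (p.1 t) := by
  have heval : Continuous fun z : I × K × I => z.2.1.1 z.2.2 :=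
    Continuous.eval (by fun_prop) (by fun_prop)
  have hdepth : Continuous fun z : I × K × I => (familyDepth c z.2.1.1 : ℝ)⁻¹ := by
    refine Continuous.inv₀
      (continuous_subtype_val.comp (continuous_familyDepth.comp (by fun_prop))) fun z => ?_
    exact (show (0 : ℝ) < familyDepth c z.2.1.1 from familyDepth_pos (hK _ z.2.1.2)).ne'
  let κ (z : I × K × I) : ℝ := (1 - z.1) + z.1 * (familyDepth c z.2.1.1 : ℝ)⁻¹
  have hκ : Continuous κ := .add (by fun_prop) (.mul (by fun_prop) hdepth)
  obtain ⟨g, hg, hgdilate⟩ := exists_homotopic_of_family (ContinuousMap.id K)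
    ⟨fun z => dilate (κ z) (z.2.1.1 z.2.2), continuous_dilate.comp (hκ.prodMk heval)⟩
    (fun s p q hq => hdilate p p.2 (κ (s, p, 0)) q hq) (fun p t => by simp [κ, dilate_one])
  exact ⟨g, hg, fun p t => by simp [hgdilate, κ]⟩

end depth

theorem exists_forall_mem_tameSub [Finite ι] (hX : X.IsNonSelfLinked)
    (hp : ∀ i, p ∈ (c i).collarSub) : ∃ q, ∀ i, q ∈ (c i).tameSub := by
  have := Fintype.ofFinite ι
  exact ⟨⟨fun t => dilate (familyDepth c p : ℝ)⁻¹ (p t),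
      continuous_dilate.comp (continuous_const.prodMk p.continuous)⟩,
    dilate_mem_tameSub_of_family hX hp fun _ => rfl⟩

theorem contractibleSpace_of_collar [Finite ι] (hX : X.IsNonSelfLinked) {r : X.CubeChain x y}
    (hr : ∀ p, (∀ i, p ∈ (c i).tameSub) → p ∈ r.tameSub) (hrK : r.strictTameSub ⊆ K)
    (hK : ∀ p ∈ K, ∀ i, p ∈ (c i).collarSub)
    (hdilate : ∀ p ∈ K, ∀ (κ : ℝ) (q : C(I, X.Realization)),
      (∀ t, q t = dilate κ (p t)) → q ∈ K) : ContractibleSpace K := by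
  have := Fintype.ofFinite ι
  obtain ⟨g, hg, hgdilate⟩ := exists_homotopic_dilate hK hdilate
  have htame (p : K) : (g p).1 ∈ r.tameSub :=
    hr _ (dilate_mem_tameSub_of_family hX (hK p p.2) (hgdilate p))
  obtain ⟨q, hq⟩ := nullhomotopic_of_tame hX hrK g htame
  exact (contractible_iff_id_nullhomotopic K).2 ⟨q, hg.trans hq⟩

end Family

end CubeChain

/-! ### Elementary refinements -/

theorem filter_eq_none_eq_map_freeIndex (c : X.Cube) (J : Fin c.1 → Option Bool) :
    (Finset.univ.filter fun i => J i = none) =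
      Finset.univ.map ⟨freeIndex c J, freeIndex_injective c J⟩ := by
  ext i
  simpa using mem_range_freeIndex.symm

theorem dim_iterFace (c : X.Cube) (J : Fin c.1 → Option Bool) :
    (X.iterFace c J).1 = (Finset.univ.filter fun i => J i = none).card := by
  rw [filter_eq_none_eq_map_freeIndex, Finset.card_map, Finset.card_univ, Fintype.card_fin]

theorem sum_eq_sum_freeIndex (c : X.Cube) {J : Fin c.1 → Option Bool} {y : Fin c.1 → I}
    (hy : OnFace J y) : ∑ i, (y i : ℝ) =
      ∑ k, (y (freeIndex c J k) : ℝ) + (Finset.univ.filter fun i => J i = some true).card := by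
  have hsplit (i : Fin c.1) : (y i : ℝ) =
      (if J i = none then (y i : ℝ) else 0) + if J i = some true then 1 else 0 := by
    rcases hi : J i with _ | _ | _
    · simp
    · simp [hy i false hi, endpoint]
    · simp [hy i true hi, endpoint]
  rw [Finset.sum_congr rfl fun i _ => hsplit i, Finset.sum_add_distrib, ← Finset.sum_filter,
    filter_eq_none_eq_map_freeIndex, Finset.sum_map, Finset.sum_boole]
  rfl

section parts

variable (e : X.Cube) (A : Finset (Fin e.1))

theorem dim_lowerPart : (X.lowerPart e A).1 = Aᶜ.card := by
  rw [lowerPart, dim_iterFace]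
  congr 1
  ext i
  simp

theorem dim_upperPart : (X.upperPart e A).1 = A.card := by
  rw [upperPart, dim_iterFace]
  congr 1
  ext i
  simp

theorem dim_upperPart_pos (hA : A ≠ ∅) : 0 < (X.upperPart e A).1 := by
  rw [dim_upperPart, Finset.card_pos, Finset.nonempty_iff_ne_empty]
  exact hA

theorem dim_lowerPart_add_dim_upperPart : (X.lowerPart e A).1 + (X.upperPart e A).1 = e.1 := by
  rw [dim_lowerPart, dim_upperPart, Finset.card_compl_add_card, Fintype.card_fin]

theorem source_lowerPart : X.source (X.lowerPart e A) = X.source e := by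
  rw [lowerPart, source_iterFace, source_eq_vertexAt]
  congr! 2 with i
  split_ifs <;> rfl

theorem target_lowerPart :
    X.target (X.lowerPart e A) = X.vertexAt e.2 fun i => decide (i ∉ A) := by
  rw [lowerPart, target_iterFace]
  congr! 2 with i
  by_cases h : i ∈ A <;> simp [h]

theorem source_upperPart :
    X.source (X.upperPart e A) = X.vertexAt e.2 fun i => decide (i ∉ A) := by
  rw [upperPart, source_iterFace]
  congr! 2 with i
  by_cases h : i ∈ A <;> simp [h]

theorem target_upperPart : X.target (X.upperPart e A) = X.target e := by
  rw [upperPart, target_iterFace, target_eq_vertexAt]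
  congr! 2 with i
  split_ifs <;> rfl

theorem exists_point_eq_of_lowerPart (z : Fin (X.lowerPart e A).1 → I) :
    ∃ y, X.point (X.lowerPart e A) z = X.point e y ∧ ∑ i, (y i : ℝ) = ∑ k, (z k : ℝ) := by
  refine ⟨faceInclusion e _ z, (point_faceInclusion e _ z).symm, ?_⟩
  have hnone : (Finset.univ.filter fun i => (if i ∈ A then some false else none) = some true) =
      ∅ := by
    ext i
    simp
  rw [sum_eq_sum_freeIndex e (onFace_faceInclusion e _ z), hnone, Finset.card_empty,
    Nat.cast_zero, add_zero]
  exact Finset.sum_congr rfl fun k _ => congrArg Subtype.val (faceInclusion_freeIndex e _ z k)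

theorem card_filter_upperPart :
    (Finset.univ.filter fun i => (if i ∈ A then none else some true) = some true).card =
      (X.lowerPart e A).1 := by
  rw [dim_lowerPart]
  congr 1
  ext i
  simp

theorem exists_point_eq_of_upperPart (z : Fin (X.upperPart e A).1 → I) :
    ∃ y, X.point (X.upperPart e A) z = X.point e y ∧
      ∑ i, (y i : ℝ) = ∑ k, (z k : ℝ) + (X.lowerPart e A).1 := by
  refine ⟨faceInclusion e _ z, (point_faceInclusion e _ z).symm, ?_⟩
  rw [sum_eq_sum_freeIndex e (onFace_faceInclusion e _ z), card_filter_upperPart]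
  congr 1
  exact Finset.sum_congr rfl fun k _ => congrArg Subtype.val (faceInclusion_freeIndex e _ z k)

theorem exists_point_upperPart_eq {y : Fin e.1 → I} (hy : ∀ i ∉ A, y i = 1) :
    ∃ z, X.point e y = X.point (X.upperPart e A) z ∧
      ∑ k, (z k : ℝ) = ∑ i, (y i : ℝ) - (X.lowerPart e A).1 := by
  have hface : OnFace (fun i => if i ∈ A then none else some true) y := by
    intro i α hi
    by_cases h : i ∈ A
    · simp [h] at hi
    · obtain rfl : true = α := by simpa [h] using hi
      exact hy i h
  refine ⟨_, (point_iterFace_comp_freeIndex hface).symm, ?_⟩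
  rw [sum_eq_sum_freeIndex e hface, card_filter_upperPart, add_sub_cancel_right]
  rfl

end parts

/-! ### Cube chains as lists -/

/-- The list `L` is a sequence of composable cubes of positive dimension from `x` to `y`. Unlike
a `CubeChain`, it may be empty, which suits inductions on the list. -/
def ChainFrom (X : BoxSet.{u}) : X.cube 0 → List X.Cube → X.cube 0 → Prop
  | x, [], y => x = y
  | x, a :: L, y => X.source a = x ∧ 0 < a.1 ∧ ChainFrom X (X.target a) L y

theorem chainFrom_append {L L' : List X.Cube} :
    X.ChainFrom x (L ++ L') y ↔ ∃ z, X.ChainFrom x L z ∧ X.ChainFrom z L' y := by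
  induction L generalizing x with
  | nil => simp [ChainFrom]
  | cons a L ih => simp [ChainFrom, ih, and_assoc]

theorem chainFrom_cons_iff {L : List X.Cube} {a : X.Cube} :
    X.ChainFrom x (a :: L) y ↔ X.source a = x ∧ (∀ c ∈ a :: L, 0 < c.1) ∧
      X.target ((a :: L).getLast (List.cons_ne_nil _ _)) = y ∧
      (a :: L).IsChain fun c d => X.target c = X.source d := by
  induction L generalizing x a with
  | nil => simp [ChainFrom]
  | cons b L ih =>
    rw [ChainFrom, ih]
    simp only [List.getLast_cons_cons, List.isChain_cons_cons, List.mem_cons, forall_eq_or_imp,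
      eq_comm (a := X.source b)]
    tauto

theorem CubeChain.chainFrom (c : X.CubeChain x y) : X.ChainFrom x c.cubes y := by
  obtain ⟨L, hL, hdim, hsource, htarget, hchain⟩ := c
  cases L with
  | nil => exact absurd rfl hL
  | cons a L => exact chainFrom_cons_iff.2 ⟨hsource, hdim, htarget, hchain⟩

theorem ChainFrom.exists_cubeChain {L : List X.Cube} (h : X.ChainFrom x L y)
    (hL : L ≠ []) : ∃ c : X.CubeChain x y, c.cubes = L := by
  cases L with
  | nil => exact absurd rfl hL
  | cons a L =>
    obtain ⟨hsource, hdim, htarget, hchain⟩ := chainFrom_cons_iff.1 h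
    exact ⟨⟨a :: L, hL, hdim, hsource, htarget, hchain⟩, rfl⟩

/-- Elementary refinement of sequences of cubes. -/
def ElemRefinesList (X : BoxSet.{u}) (L' L : List X.Cube) : Prop :=
  ∃ (a b : List X.Cube) (e : X.Cube) (A : Finset (Fin e.1)), A ≠ ∅ ∧ A ≠ Finset.univ ∧
    L = a ++ e :: b ∧ L' = a ++ X.lowerPart e A :: X.upperPart e A :: b

theorem ElemRefinesList.chainFrom {L' L : List X.Cube}
    (h : X.ElemRefinesList L' L) (hL : X.ChainFrom x L y) : X.ChainFrom x L' y := by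
  obtain ⟨a, b, e, A, hA, hA', rfl, rfl⟩ := h
  obtain ⟨z, hz, hsource, -, hb⟩ := chainFrom_append.1 hL
  refine chainFrom_append.2 ⟨z, hz, (source_lowerPart e A).trans hsource, ?_,
    (source_upperPart e A).trans (target_lowerPart e A).symm, dim_upperPart_pos e A hA,
    by rwa [target_upperPart]⟩
  rw [dim_lowerPart, Finset.card_pos, Finset.nonempty_iff_ne_empty]
  simpa using hA'

theorem ElemRefinesList.ne_nil {L' L : List X.Cube} (h : X.ElemRefinesList L' L) : L' ≠ [] := by
  obtain ⟨a, b, e, A, -, -, -, rfl⟩ := h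
  simp

theorem CubeChain.exists_refines_of_list (c : X.CubeChain x y) {L : List X.Cube}
    (h : Relation.ReflTransGen X.ElemRefinesList L c.cubes) :
    ∃ c' : X.CubeChain x y, c'.cubes = L ∧ c'.Refines c := by
  induction h using Relation.ReflTransGen.head_induction_on with
  | refl => exact ⟨c, rfl, .refl⟩
  | head h _ ih =>
    obtain ⟨d, rfl, hdc⟩ := ih
    obtain ⟨c', rfl⟩ := (h.chainFrom d.chainFrom).exists_cubeChain h.ne_nil
    exact ⟨c', rfl, hdc.head h⟩

theorem reflTransGen_elemRefinesList_cons (a : X.Cube) {L L' : List X.Cube}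
    (h : Relation.ReflTransGen X.ElemRefinesList L' L) :
    Relation.ReflTransGen X.ElemRefinesList (a :: L') (a :: L) := by
  refine h.lift (a :: ·) ?_
  rintro _ _ ⟨l, b, e, A, hA, hA', rfl, rfl⟩
  exact ⟨a :: l, b, e, A, hA, hA', rfl, rfl⟩

/-- The sum of the dimensions of a list of cubes. -/
def totalDim (L : List X.Cube) : ℕ := (L.map Sigma.fst).sum

theorem totalDim_cons (a : X.Cube) (L : List X.Cube) : totalDim (a :: L) = a.1 + totalDim L := by
  simp [totalDim]

theorem coe_totalDim_cons (a : X.Cube) (L : List X.Cube) :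
    (totalDim (a :: L) : ℝ) = a.1 + totalDim L := by
  rw [totalDim_cons, Nat.cast_add]

theorem ElemRefinesList.totalDim_eq {L' L : List X.Cube} (h : X.ElemRefinesList L' L) :
    totalDim L' = totalDim L := by
  obtain ⟨a, b, e, A, -, -, rfl, rfl⟩ := h
  simp [totalDim, ← dim_lowerPart_add_dim_upperPart e A, add_assoc]

theorem totalDim_eq_of_reflTransGen {L' L : List X.Cube}
    (h : Relation.ReflTransGen X.ElemRefinesList L' L) : totalDim L' = totalDim L := by
  induction h with
  | refl => rfl
  | tail _ h ih => exact ih.trans h.totalDim_eq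

theorem partialDim_cons_succ (a : X.Cube) (L : List X.Cube) (i : ℕ) :
    partialDim (a :: L).get (i + 1) = a.1 + partialDim L.get i := by
  simp only [partialDim]
  refine (Fin.sum_univ_succ (n := L.length) _).trans ?_
  simp

theorem partialDim_length (L : List X.Cube) : partialDim L.get L.length = totalDim L := by
  induction L with
  | nil => simp [partialDim, totalDim]
  | cons a L ih => rw [coe_totalDim_cons, ← ih]; exact partialDim_cons_succ a L L.length

/-! ### Paths running through lists of cubes -/

/-- While `ℓ` increases from `k` to `k + dim a`, the path `p` runs in the cube `a`, with the sum of
its coordinates equal to `ℓ - k`. -/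
def RunsIn (p : C(I, X.Realization)) (ℓ : I → ℝ) (k : ℝ) (a : X.Cube) : Prop :=
  ∀ t, k ≤ ℓ t → ℓ t ≤ k + a.1 → ∃ z, p t = X.point a z ∧ ∑ i, (z i : ℝ) = ℓ t - k

/-- From the level `ℓ = k` on, the path `p` runs through the cubes of a list. -/
def RunsThrough (p : C(I, X.Realization)) (ℓ : I → ℝ) : ℝ → List X.Cube → Prop
  | _, [] => True
  | k, a :: L => RunsIn p ℓ k a ∧ RunsThrough p ℓ (k + a.1) L

section

variable {p : C(I, X.Realization)} {ℓ : I → ℝ} {k : ℝ}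

theorem runsThrough_iff {L : List X.Cube} : RunsThrough p ℓ k L ↔
    ∀ i : Fin L.length, RunsIn p ℓ (k + partialDim L.get i) (L.get i) := by
  induction L generalizing k with
  | nil => simp [RunsThrough]
  | cons a L ih =>
    rw [RunsThrough, ih]
    refine Iff.trans (and_congr ?_ (forall_congr' fun i => ?_)) (Fin.forall_fin_succ
      (P := fun i : Fin (L.length + 1) =>
        RunsIn p ℓ (k + partialDim (a :: L).get i) ((a :: L).get i))).symm
    · rw [Fin.val_zero, partialDim_zero, add_zero]
      rfl
    · rw [Fin.val_succ, partialDim_cons_succ, add_assoc]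
      rfl

theorem isLength_iff {L : List X.Cube} : IsLength p L.get ℓ ↔
    IsSchedule (totalDim L : ℝ) ℓ ∧ (∀ t, (ℓ t : AddCircle (1 : ℝ)) = phase (p t)) ∧
      RunsThrough p ℓ 0 L := by
  rw [runsThrough_iff, ← partialDim_length]
  simp only [zero_add, RunsIn, ← partialDim_succ]
  exact ⟨fun h => ⟨h.toIsSchedule, h.lifts, h.follows⟩,
    fun ⟨hschedule, hlifts, hfollows⟩ => ⟨hschedule, hlifts, hfollows⟩⟩

theorem RunsIn.of_parts {e : X.Cube} {A : Finset (Fin e.1)}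
    (hlower : RunsIn p ℓ k (X.lowerPart e A))
    (hupper : RunsIn p ℓ (k + (X.lowerPart e A).1) (X.upperPart e A)) : RunsIn p ℓ k e := by
  have hdim : ((X.lowerPart e A).1 : ℝ) + (X.upperPart e A).1 = e.1 := by
    exact_mod_cast dim_lowerPart_add_dim_upperPart e A
  intro t ht ht'
  rcases le_total (ℓ t) (k + (X.lowerPart e A).1) with h | h
  · obtain ⟨z, hz, hsum⟩ := hlower t ht h
    obtain ⟨y, hy, hysum⟩ := exists_point_eq_of_lowerPart e A z
    exact ⟨y, hz.trans hy, hysum.trans hsum⟩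
  · obtain ⟨z, hz, hsum⟩ := hupper t h (by linarith)
    obtain ⟨y, hy, hysum⟩ := exists_point_eq_of_upperPart e A z
    exact ⟨y, hz.trans hy, by rw [hysum, hsum]; ring⟩

theorem ElemRefinesList.runsThrough {L' L : List X.Cube} (h : X.ElemRefinesList L' L)
    (hL' : RunsThrough p ℓ k L') : RunsThrough p ℓ k L := by
  obtain ⟨a, b, e, A, -, -, rfl, rfl⟩ := h
  induction a generalizing k with
  | nil =>
    obtain ⟨hlower, hupper, hb⟩ := hL'
    refine ⟨hlower.of_parts hupper, ?_⟩
    rwa [← dim_lowerPart_add_dim_upperPart e A, Nat.cast_add, ← add_assoc]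
  | cons c a ih => exact ⟨hL'.1, ih hL'.2⟩

end

namespace CubeChain

variable {c c' : X.CubeChain x y}

theorem ElemRefines.tameSub_subset (hX : X.IsNonSelfLinked) (h : c'.ElemRefines c) :
    c'.tameSub ⊆ c.tameSub := by
  intro p hp
  obtain ⟨ℓ, hℓ⟩ := c'.exists_isLength hp
  obtain ⟨hschedule, hlifts, hruns⟩ := isLength_iff.1 hℓ
  have hlist : X.ElemRefinesList c'.cubes c.cubes := h
  exact mem_tameSub_of_isLength hX hp.1.1.2.2.some
    (isLength_iff.2 ⟨hlist.totalDim_eq ▸ hschedule, hlifts, hlist.runsThrough hruns⟩)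

theorem Refines.tameSub_subset (hX : X.IsNonSelfLinked) (h : c'.Refines c) :
    c'.tameSub ⊆ c.tameSub := by
  induction h with
  | refl => exact subset_rfl
  | tail _ h ih => exact ih.trans (h.tameSub_subset hX)

end CubeChain

/-! ### Common refinements -/

theorem IsSchedule.exists_eq {T : ℝ} {ℓ : I → ℝ} (h : IsSchedule T ℓ) {v : ℝ} (hv : 0 ≤ v)
    (hvT : v ≤ T) : ∃ t, ℓ t = v := by
  obtain ⟨t, -, ht⟩ := intermediate_value_Icc (zero_le_one (α := I)) h.continuous.continuousOn
    (show v ∈ Set.Icc (ℓ 0) (ℓ 1) from ⟨h.zero.trans_le hv, hvT.trans_eq h.one.symm⟩)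
  exact ⟨t, ht⟩

section

variable {p : C(I, X.Realization)} {ℓ : I → ℝ} {T k : ℝ} {a b : X.Cube}

theorem RunsIn.apply_eq_target (h : RunsIn p ℓ k a) {t : I} (ht : ℓ t = k + a.1) :
    p t = X.vertex (X.target a) := by
  obtain ⟨z, hz, hsum⟩ := h t (by rw [ht]; simp) ht.le
  rw [hz, eq_one_of_sum_eq (x := z) (by rw [hsum, ht]; ring), point_one]

theorem RunsIn.exists_target_lowerPart_eq (h : RunsIn p ℓ k b) {t : I} (ht : k ≤ ℓ t)
    (ht' : ℓ t ≤ k + b.1) {v : X.cube 0} (hv : p t = X.vertex v) :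
    ∃ A, X.target (X.lowerPart b A) = v := by
  obtain ⟨z, hz, -⟩ := h t ht ht'
  obtain ⟨w, rfl⟩ := exists_eq_endpoint_of_point_eq_vertex (hz.symm.trans hv)
  rw [hz, point_endpoint] at hv
  refine ⟨Finset.univ.filter fun i => w i = false, ?_⟩
  rw [target_lowerPart, ← vertex_injective hv]
  congr 1 with i
  cases hw : w i <;> simp [hw]

theorem exists_eq_lowerPart (hP : X.IsProper) (hℓ : IsSchedule T ℓ) (hk : 0 ≤ k)
    (hT : k + a.1 ≤ T) (hsource : X.source a = X.source b) (ha : 0 < a.1) (hab : a.1 < b.1)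
    (hruns : RunsIn p ℓ k a) (hruns' : RunsIn p ℓ k b) :
    ∃ A : Finset (Fin b.1), A ≠ ∅ ∧ A ≠ Finset.univ ∧ X.lowerPart b A = a := by
  obtain ⟨t, ht⟩ := hℓ.exists_eq (by positivity) hT
  have hab' : (a.1 : ℝ) ≤ b.1 := by exact_mod_cast hab.le
  obtain ⟨A, hA⟩ := hruns'.exists_target_lowerPart_eq (by rw [ht]; simp) (by linarith)
    (hruns.apply_eq_target ht)
  obtain rfl : X.lowerPart b A = a := hP _ _ ((source_lowerPart b A).trans hsource.symm) hA
  rw [dim_lowerPart] at ha hab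
  refine ⟨A, ?_, ?_, rfl⟩
  · rintro rfl
    simp at hab
  · rintro rfl
    simp at ha

theorem RunsIn.eq_one_of_notMem (hX : X.IsNonSelfLinked) (hp : Nonempty (X.Presentation p))
    (hℓ : IsSchedule T ℓ) (hk : 0 ≤ k) (hT : k + b.1 ≤ T) {A : Finset (Fin b.1)}
    (hlower : RunsIn p ℓ k (X.lowerPart b A)) (hruns : RunsIn p ℓ k b) {t : I}
    (ht : k + (X.lowerPart b A).1 ≤ ℓ t) (ht' : ℓ t ≤ k + b.1) {z : Fin b.1 → I}
    (hz : p t = X.point b z) {i : Fin b.1} (hi : i ∉ A) : z i = 1 := by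
  have hlower_nonneg : (0 : ℝ) ≤ (X.lowerPart b A).1 := Nat.cast_nonneg _
  have hvertex : ∀ s, ℓ s = k + (X.lowerPart b A).1 →
      p s = X.point b fun i => endpoint (decide (i ∉ A)) := fun s hs => by
    rw [hlower.apply_eq_target hs, target_lowerPart, ← point_endpoint]
  obtain ⟨s, hs⟩ := hℓ.exists_eq (add_nonneg hk hlower_nonneg) (by linarith)
  rcases le_total s t with hst | hts
  · have hcoords := hp.some.coords_le hX (c := b) hst (fun r hr => by
      obtain ⟨y, hy, -⟩ := hruns r (by linarith [hℓ.monotone hr.1])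
        (by linarith [hℓ.monotone hr.2])
      exact ⟨y, hy.symm⟩) i
    rw [hvertex s hs, hz, hX.coords_point, hX.coords_point] at hcoords
    exact le_antisymm unitInterval.le_one' (by simpa [hi, endpoint] using hcoords)
  · have heq := hvertex t (le_antisymm ((hℓ.monotone hts).trans_eq hs) ht)
    rw [hX.point_injective b (hz.symm.trans heq)]
    simp [hi, endpoint]

theorem RunsIn.upperPart (hX : X.IsNonSelfLinked) (hp : Nonempty (X.Presentation p))
    (hℓ : IsSchedule T ℓ) (hk : 0 ≤ k) (hT : k + b.1 ≤ T) {A : Finset (Fin b.1)}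
    (hlower : RunsIn p ℓ k (X.lowerPart b A)) (hruns : RunsIn p ℓ k b) :
    RunsIn p ℓ (k + (X.lowerPart b A).1) (X.upperPart b A) := by
  have hdim : ((X.lowerPart b A).1 : ℝ) + (X.upperPart b A).1 = b.1 := by
    exact_mod_cast dim_lowerPart_add_dim_upperPart b A
  intro t ht ht'
  rw [add_assoc, hdim] at ht'
  obtain ⟨z, hz, hsum⟩ := hruns t (le_of_add_le_of_nonneg_left ht (Nat.cast_nonneg _)) ht'
  obtain ⟨z', hz', hsum'⟩ := exists_point_upperPart_eq b A
    fun i hi => hlower.eq_one_of_notMem hX hp hℓ hk hT hruns ht ht' hz hi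
  exact ⟨z', hz.trans hz', by rw [hsum', hsum]; ring⟩

end

/-- The sequences `L` and `L'` have a common refinement through which runs every directed path that
runs through both of them from the level `k` on. Here `T` is the total length of the paths. -/
def HasMeet (X : BoxSet.{u}) (T k : ℝ) (L L' : List X.Cube) : Prop :=
  ∃ M, Relation.ReflTransGen X.ElemRefinesList M L ∧ Relation.ReflTransGen X.ElemRefinesList M L' ∧
    ∀ (p : C(I, X.Realization)) (ℓ : I → ℝ), Nonempty (X.Presentation p) → IsSchedule T ℓ →
      RunsThrough p ℓ k L → RunsThrough p ℓ k L' → RunsThrough p ℓ k M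

namespace HasMeet

variable {T k : ℝ} {L L' : List X.Cube}

theorem symm (h : X.HasMeet T k L L') : X.HasMeet T k L' L := by
  obtain ⟨M, hML, hML', hM⟩ := h
  exact ⟨M, hML', hML, fun p ℓ hp hℓ hL hL' => hM p ℓ hp hℓ hL' hL⟩

theorem cons {a : X.Cube} (h : X.HasMeet T (k + a.1) L L') :
    X.HasMeet T k (a :: L) (a :: L') := by
  obtain ⟨M, hML, hML', hM⟩ := h
  exact ⟨a :: M, reflTransGen_elemRefinesList_cons a hML, reflTransGen_elemRefinesList_cons a hML',
    fun p ℓ hp hℓ hL hL' => ⟨hL.1, hM p ℓ hp hℓ hL.2 hL'.2⟩⟩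

end HasMeet

/-- The path `p` runs through the sequence `L` of composable cubes from `x` to `y` while `ℓ`
increases from `k` to `T`. -/
structure Traces (p : C(I, X.Realization)) (ℓ : I → ℝ) (T : ℝ) (y : X.cube 0) (k : ℝ)
    (x : X.cube 0) (L : List X.Cube) : Prop where
  chain : X.ChainFrom x L y
  level : k + totalDim L = T
  runs : RunsThrough p ℓ k L

section

variable {p : C(I, X.Realization)} {ℓ : I → ℝ} {T k : ℝ} {a b : X.Cube}
  {L L' : List X.Cube}

theorem RunsThrough.upperPart (hX : X.IsNonSelfLinked) (hp : Nonempty (X.Presentation p))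
    (hℓ : IsSchedule T ℓ) (hk : 0 ≤ k) (hT : k + b.1 ≤ T) {A : Finset (Fin b.1)}
    (hlower : RunsIn p ℓ k (X.lowerPart b A)) (hruns : RunsThrough p ℓ k (b :: L)) :
    RunsThrough p ℓ (k + (X.lowerPart b A).1) (X.upperPart b A :: L) := by
  refine ⟨hlower.upperPart hX hp hℓ hk hT hruns.1, ?_⟩
  rw [add_assoc, ← Nat.cast_add, dim_lowerPart_add_dim_upperPart]
  exact hruns.2

theorem HasMeet.lowerPart_cons (hX : X.IsNonSelfLinked) (hk : 0 ≤ k) (hT : k + b.1 ≤ T)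
    {A : Finset (Fin b.1)} (hA : A ≠ ∅) (hA' : A ≠ Finset.univ)
    (h : X.HasMeet T (k + (X.lowerPart b A).1) L (X.upperPart b A :: L')) :
    X.HasMeet T k (X.lowerPart b A :: L) (b :: L') := by
  obtain ⟨M, hML, hML', hM⟩ := h
  exact ⟨X.lowerPart b A :: M, reflTransGen_elemRefinesList_cons _ hML,
    (reflTransGen_elemRefinesList_cons _ hML').tail ⟨[], L', b, A, hA, hA', rfl, rfl⟩,
    fun p ℓ hp hℓ hL hL' => ⟨hL.1, hM p ℓ hp hℓ hL.2 (hL'.upperPart hX hp hℓ hk hT hL.1)⟩⟩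

namespace Traces

theorem dim_le (h : Traces p ℓ T y k x (a :: L)) : k + a.1 ≤ T := by
  rw [← h.level, coe_totalDim_cons, ← add_assoc]
  exact le_add_of_nonneg_right (Nat.cast_nonneg _)

theorem not_cons (h : Traces p ℓ k y k x (a :: L)) : False := by
  have ha : (0 : ℝ) < a.1 := Nat.cast_pos.2 h.chain.2.1
  linarith [h.dim_le]

theorem tail (h : Traces p ℓ T y k x (a :: L)) : Traces p ℓ T y (k + a.1) (X.target a) L where
  chain := h.chain.2.2
  level := by rw [← h.level, coe_totalDim_cons, add_assoc]
  runs := h.runs.2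

theorem upperPart (hX : X.IsNonSelfLinked) (hp : Nonempty (X.Presentation p))
    (hℓ : IsSchedule T ℓ) (hk : 0 ≤ k) {A : Finset (Fin b.1)} (hA : A ≠ ∅)
    (h : Traces p ℓ T y k x (b :: L)) (hlower : RunsIn p ℓ k (X.lowerPart b A)) :
    Traces p ℓ T y (k + (X.lowerPart b A).1) (X.target (X.lowerPart b A))
      (X.upperPart b A :: L) where
  chain := by
    refine ⟨(source_upperPart b A).trans (target_lowerPart b A).symm, dim_upperPart_pos b A hA, ?_⟩
    rw [target_upperPart]
    exact h.chain.2.2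
  level := by
    rw [← h.level, coe_totalDim_cons, coe_totalDim_cons, ← dim_lowerPart_add_dim_upperPart b A]
    push_cast
    ring
  runs := h.runs.upperPart hX hp hℓ hk h.dim_le hlower

theorem hasMeet (hX : X.IsNonSelfLinked) (hP : X.IsProper) (hp : Nonempty (X.Presentation p))
    (hℓ : IsSchedule T ℓ) {k : ℝ} (hk : 0 ≤ k) {x : X.cube 0} {L L' : List X.Cube}
    (h : Traces p ℓ T y k x L) (h' : Traces p ℓ T y k x L') : X.HasMeet T k L L' := by
  match L, L' with
  | [], [] => exact ⟨[], .refl, .refl, fun _ _ _ _ hL _ => hL⟩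
  | [], b :: bs =>
    obtain rfl : k = T := by simpa [totalDim] using h.level
    exact h'.not_cons.elim
  | a :: as, [] =>
    obtain rfl : k = T := by simpa [totalDim] using h'.level
    exact h.not_cons.elim
  | a :: as, b :: bs =>
    have hsource : X.source a = X.source b := h.chain.1.trans h'.chain.1.symm
    rcases lt_trichotomy a.1 b.1 with hab | hab | hab
    · obtain ⟨A, hA, hA', rfl⟩ := exists_eq_lowerPart hP hℓ hk h.dim_le hsource h.chain.2.1 hab
        h.runs.1 h'.runs.1
      exact .lowerPart_cons hX hk h'.dim_le hA hA' <| hasMeet hX hP hp hℓ (by positivity) h.tail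
        (h'.upperPart hX hp hℓ hk hA h.runs.1)
    · obtain ⟨t, ht⟩ := hℓ.exists_eq (by positivity) h.dim_le
      obtain rfl : a = b := hP a b hsource <| vertex_injective <|
        (h.runs.1.apply_eq_target ht).symm.trans (h'.runs.1.apply_eq_target (by rw [ht, hab]))
      exact (hasMeet hX hP hp hℓ (by positivity) h.tail h'.tail).cons
    · obtain ⟨A, hA, hA', rfl⟩ := exists_eq_lowerPart hP hℓ hk h'.dim_le hsource.symm
        h'.chain.2.1 hab h'.runs.1 h.runs.1
      exact (HasMeet.lowerPart_cons hX hk h.dim_le hA hA' <| hasMeet hX hP hp hℓ (by positivity)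
        h'.tail (h.upperPart hX hp hℓ hk hA h'.runs.1)).symm
termination_by L.length + L'.length

end Traces

end

namespace CubeChain

theorem traces {p : C(I, X.Realization)} {ℓ : I → ℝ} {T : ℝ} (c : X.CubeChain x y)
    (hℓ : IsLength p c.cubes.get ℓ) (hT : IsSchedule T ℓ) : Traces p ℓ T y 0 x c.cubes where
  chain := c.chainFrom
  level := by rw [zero_add, ← (isLength_iff.1 hℓ).1.one, hT.one]
  runs := (isLength_iff.1 hℓ).2.2

theorem exists_meet (hX : X.IsNonSelfLinked) (hP : X.IsProper) (c c' : X.CubeChain x y)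
    (h : (c.tameSub ∩ c'.tameSub).Nonempty) :
    ∃ r : X.CubeChain x y, r.Refines c ∧ r.Refines c' ∧ c.tameSub ∩ c'.tameSub ⊆ r.tameSub := by
  have common_length : ∀ q ∈ c.tameSub ∩ c'.tameSub, ∃ ℓ, IsLength q c.cubes.get ℓ ∧
      IsLength q c'.cubes.get ℓ := by
    intro q hq
    obtain ⟨ℓ, hℓ⟩ := c.exists_isLength hq.1
    obtain ⟨ℓ', hℓ'⟩ := c'.exists_isLength hq.2
    obtain rfl := hℓ.unique hℓ'
    exact ⟨ℓ, hℓ, hℓ'⟩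
  obtain ⟨p, hp⟩ := h
  obtain ⟨ℓ, hℓ, hℓ'⟩ := common_length p hp
  have hschedule := (isLength_iff.1 hℓ).1
  obtain ⟨M, hMc, hMc', hM⟩ := Traces.hasMeet hX hP hp.1.1.1.2.2 hschedule le_rfl
    (c.traces hℓ hschedule) (c'.traces hℓ' hschedule)
  obtain ⟨r, rfl, hrc⟩ := exists_refines_of_list c hMc
  obtain ⟨r', hr', hrc'⟩ := exists_refines_of_list c' hMc'
  obtain rfl : r' = r := by
    cases r; cases r'
    exact (CubeChain.mk.injEq ..).mpr hr'
  refine ⟨r', hrc, hrc', fun q hq => ?_⟩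
  obtain ⟨ℓ, hℓ, hℓ'⟩ := common_length q hq
  obtain ⟨hschedule, hlifts, hruns⟩ := isLength_iff.1 hℓ
  obtain ⟨-, -, hruns'⟩ := isLength_iff.1 hℓ'
  have hq' := hq.1.1.1.2.2
  exact mem_tameSub_of_isLength hX hq'.some (isLength_iff.2
    ⟨totalDim_eq_of_reflTransGen hMc ▸ hschedule, hlifts, hM q ℓ hq' hschedule hruns hruns'⟩)

theorem exists_common_refinement (hX : X.IsNonSelfLinked) (hP : X.IsProper) {k : ℕ} (hk : 0 < k)
    (c : Fin k → X.CubeChain x y) {p : C(I, X.Realization)} (hp : ∀ i, p ∈ (c i).tameSub) :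
    ∃ r : X.CubeChain x y, (∀ i, r.Refines (c i)) ∧
      ∀ q, (∀ i, q ∈ (c i).tameSub) → q ∈ r.tameSub := by
  induction k, hk using Nat.le_induction with
  | base => exact ⟨c 0, fun i => by rw [Subsingleton.elim i 0]; exact .refl, fun q hq => hq 0⟩
  | succ k _ ih =>
    obtain ⟨r, hr, hmem⟩ := ih (fun i => c i.castSucc) fun i => hp _
    obtain ⟨r', hr'r, hr'last, hmem'⟩ := exists_meet hX hP r (c (Fin.last k))
      ⟨p, hmem p fun i => hp _, hp _⟩
    exact ⟨r', Fin.lastCases hr'last fun i => hr'r.trans (hr i),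
      fun q hq => hmem' ⟨hmem q fun i => hq _, hq _⟩⟩

section Refinement

variable {k : ℕ} {c : Fin k → X.CubeChain x y} {r : X.CubeChain x y}

theorem contractibleSpace_of_refines (hX : X.IsNonSelfLinked) (hP : X.IsProper) (hk : 0 < k)
    (hr : ∀ i, r.Refines (c i)) {K : Set C(I, X.Realization)}
    (hstrict : ∀ p, (∀ i, p ∈ (c i).strictTameSub) → p ∈ K)
    (hcollar : ∀ p ∈ K, ∀ i, p ∈ (c i).collarSub)
    (hdilate : ∀ p ∈ K, ∀ (κ : ℝ) (q : C(I, X.Realization)),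
      (∀ t, q t = dilate κ (p t)) → q ∈ K) : ContractibleSpace K := by
  obtain ⟨p, hp, -⟩ := r.exists_follows_diagonal
  obtain ⟨m, hm, htame⟩ := exists_common_refinement hX hP hk c
    fun i => (hr i).tameSub_subset hX hp.1
  exact contractibleSpace_of_collar hX htame
    (fun q hq => hstrict q fun i => ⟨(hm i).tameSub_subset hX hq.1, hq.2⟩) hcollar hdilate

theorem contractibleSpace_iInter_strictCollarSub (hX : X.IsNonSelfLinked) (hP : X.IsProper)
    (hk : 0 < k) (hr : ∀ i, r.Refines (c i)) :
    ContractibleSpace (⋂ i, (c i).strictCollarSub : Set C(I, X.Realization)) :=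
  contractibleSpace_of_refines hX hP hk hr
    (fun _ hp => Set.mem_iInter.2 fun i => strictTameSub_subset_strictCollarSub (c i) (hp i))
    (fun _ hp i => (Set.mem_iInter.1 hp i).1)
    fun _ hp _ _ hq => Set.mem_iInter.2 fun i =>
      ⟨dilate_mem_collarSub (Set.mem_iInter.1 hp i).1 hq,
        dilate_mem_strictPaths (Set.mem_iInter.1 hp i).2 hq⟩

theorem contractibleSpace_iInter_collarSub (hX : X.IsNonSelfLinked) (hP : X.IsProper)
    (hk : 0 < k) (hr : ∀ i, r.Refines (c i)) :
    ContractibleSpace (⋂ i, (c i).collarSub : Set C(I, X.Realization)) :=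
  contractibleSpace_of_refines hX hP hk hr
    (fun _ hp => Set.mem_iInter.2 fun i => tameSub_subset_collarSub (c i) (hp i).1)
    (fun _ hp => Set.mem_iInter.1 hp)
    fun _ hp _ _ hq => Set.mem_iInter.2 fun i => dilate_mem_collarSub (Set.mem_iInter.1 hp i) hq

theorem exists_refines_of_nonempty_iInter (hX : X.IsNonSelfLinked) (hP : X.IsProper) (hk : 0 < k)
    (h : (⋂ i, (c i).collarSub).Nonempty) : ∃ r : X.CubeChain x y, ∀ i, r.Refines (c i) := by
  obtain ⟨p, hp⟩ := h
  obtain ⟨q, hq⟩ := exists_forall_mem_tameSub hX (Set.mem_iInter.1 hp)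
  obtain ⟨r, hr, -⟩ := exists_common_refinement hX hP hk c hq
  exact ⟨r, hr⟩

end Refinement

end CubeChain

end BoxSet

theorem mainTheorem7 (X : BoxSet.{u}) (hproper : X.IsProper) (hnsl : X.IsNonSelfLinked)
    (xm xp : X.cube 0) :
    (∀ c : X.CubeChain xm xp,
      (ContractibleSpace c.strictTameSub ∧ ContractibleSpace c.tameSub) ∧
      (ContractibleSpace c.strictCollarSub ∧ ContractibleSpace c.collarSub)) ∧
    (∀ (k : ℕ) (_ : 0 < k) (c : Fin k → X.CubeChain xm xp),
      ((∃ r : X.CubeChain xm xp, ∀ i, r.Refines (c i)) →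
        ContractibleSpace (⋂ i, (c i).strictCollarSub : Set C(unitInterval, X.Realization)) ∧
        ContractibleSpace (⋂ i, (c i).collarSub : Set C(unitInterval, X.Realization))) ∧
      ((¬ ∃ r : X.CubeChain xm xp, ∀ i, r.Refines (c i)) →
        (⋂ i, (c i).strictCollarSub) = (∅ : Set C(unitInterval, X.Realization)) ∧
        (⋂ i, (c i).collarSub) = (∅ : Set C(unitInterval, X.Realization)))) := by
  have contractible_collar : ∀ c : X.CubeChain xm xp,
      ContractibleSpace c.strictCollarSub ∧ ContractibleSpace c.collarSub := by
    intro c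
    have hrefines : ∀ _ : Fin 1, c.Refines c := fun _ => .refl
    have hstrict :=
      BoxSet.CubeChain.contractibleSpace_iInter_strictCollarSub hnsl hproper one_pos hrefines
    have hcollar :=
      BoxSet.CubeChain.contractibleSpace_iInter_collarSub hnsl hproper one_pos hrefines
    rw [Set.iInter_const] at hstrict hcollar
    exact ⟨hstrict, hcollar⟩
  refine ⟨fun c => ⟨⟨?_, ?_⟩, contractible_collar c⟩,
    fun k hk c => ⟨fun ⟨r, hr⟩ => ⟨?_, ?_⟩, fun h => ?_⟩⟩
  · exact c.contractibleSpace_of_tame hnsl subset_rfl Set.inter_subset_left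
  · exact c.contractibleSpace_of_tame hnsl Set.inter_subset_left subset_rfl
  · exact BoxSet.CubeChain.contractibleSpace_iInter_strictCollarSub hnsl hproper hk hr
  · exact BoxSet.CubeChain.contractibleSpace_iInter_collarSub hnsl hproper hk hr
  · have empty_collar : (⋂ i, (c i).collarSub) = ∅ := Set.not_nonempty_iff_eq_empty.1 fun hne =>
      h (BoxSet.CubeChain.exists_refines_of_nonempty_iInter hnsl hproper hk hne)
    exact ⟨Set.subset_eq_empty (Set.iInter_mono fun i => Set.inter_subset_left) empty_collar,
      empty_collar⟩
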